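/- Let $k$ be an algebraically closed field. A $k$-linear category $A$ is a \emph{bounded category} if it has finitely many objects, different objects are non-isomorphic, all endomorphism algebras $A(a,a)$ are local, and $\bigoplus_{x}A(a,x)$ and $\bigoplus_{x}A(x,a)$ are finite-dimensional over $k$ for every $a\in A$. Let $\operatorname{mod}A$ be the abelian category of covariant $k$-linear functors $M$ from $A$ to finite-dimensional $k$-vector spaces, with $\dim M=\sum_{a\in A}\dim_k M(a)$; $A$ has finite global dimension if the projective dimensions of the objects of $\operatorname{mod}A$ have a common finite bound. For an integer $m\ge 0$, let $C_m(\operatorname{proj}A)$ be the full subcategory of the category of complexes over $\operatorname{mod}A$ consisting of the complexes $P^\bullet=(P^i,d^i)$ of projective modules with $P^i=0$ for $i\notin\{0,1,\dots,m\}$ which are minimal, i.e. $\operatorname{Im}d^i\subseteq\operatorname{rad}P^{i+1}$ for all $i$ (where $\operatorname{rad}$ is the intersection of the maximal submodules); put $\dim P^\bullet=\sum_{i=0}^m\dim P^i$. The category $C_m(\operatorname{proj}A)$ is \emph{of strongly unbounded type} if there is a strictly increasing sequence $(d_i)_{i\in\mathbb N}$ of natural numbers such that, for each $i$, there are infinitely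 many pairwise non-isomorphic indecomposable objects of dimension $d_i$ in $C_m(\operatorname{proj}A)$. A $k$-linear functor $F:B\to A$ between bounded categories is \emph{cleaving} if the linear maps $B(b,b')\to A(Fb,Fb')$ induced by $F$ admit $k$-linear retractions $r_{b,b'}:A(Fb,Fb')\to B(b,b')$ that are natural in $b$ and $b'$. Let $A$ and $B$ be bounded categories, let $B$ have finite global dimension, let $m\ge 0$ be an integer such that $C_m(\operatorname{proj}B)$ is of strongly unbounded type, and let $F:B\to A$ be a cleaving functor. Then $C_m(\operatorname{proj}A)$ is of strongly unbounded type. -/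

import Mathlib

open CategoryTheory CategoryTheory.Limits

universe w v u v' u'

namespace CleavingFunctors

section BoundedCategories

/-- A `k`-linear category is *locally bounded* if distinct objects are non-isomorphic, endomorphism
algebras are local, and for every `a` both `⨁ x, A(a, x)` and `⨁ x, A(x, a)` are
finite-dimensional. -/
structure IsLocallyBounded (k : Type w) [Field k] (A : Type u) [Category.{v} A] [Preadditive A]
    [Linear k A] : Prop where
  eq_of_iso : ∀ x y : A, Nonempty (x ≅ y) → x = y
  isLocalRing_end : ∀ a : A, IsLocalRing (End a)
  finite_out : ∀ a : A, Module.Finite k (DirectSum A fun x => (a ⟶ x))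
  finite_in : ∀ a : A, Module.Finite k (DirectSum A fun x => (x ⟶ a))

/-- A *bounded category* is a locally bounded category with finitely many objects. -/
structure IsBoundedCategory (k : Type w) [Field k] (A : Type u) [Category.{v} A] [Preadditive A]
    [Linear k A] : Prop extends IsLocallyBounded k A where
  finite_obj : Finite A

end BoundedCategories

section Modules

variable (k : Type w) [Field k] (A : Type u) [Category.{v} A] [Preadditive A] [Linear k A]

/-- The covariant `k`-linear functors `M` from `A` to `k`-vector spaces such that every `M a` is
finite-dimensional and the support of `M` is finite. -/
structure IsFinDimModule (M : A ⥤ ModuleCat.{v} k) : Prop where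
  map_add : ∀ {a b : A} (f g : a ⟶ b), M.map (f + g) = M.map f + M.map g
  map_smul : ∀ {a b : A} (c : k) (f : a ⟶ b), M.map (c • f) = c • M.map f
  finite_obj : ∀ a : A, Module.Finite k (M.obj a)
  finite_support : {a : A | Nontrivial (M.obj a)}.Finite

/-- `IsFinDimModule` as a property of objects of the functor category. -/
abbrev finDimModule : ObjectProperty (A ⥤ ModuleCat.{v} k) := fun M => IsFinDimModule k A M

/-- The category `mod A` of finite-dimensional right `A`-modules. -/
abbrev FinMod := (finDimModule k A).FullSubcategory

variable {k A}

/-- A functor embedding into finitely many finite-dimensional modules is one itself. -/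
theorem IsFinDimModule.of_jointly_injective {J : Type*} [Finite J] {N : A ⥤ ModuleCat.{v} k}
    (M : J → (A ⥤ ModuleCat.{v} k)) (hM : ∀ j, IsFinDimModule k A (M j)) (f : ∀ j, N ⟶ M j)
    (hf : ∀ (a : A) (x y : N.obj a), (∀ j, (f j).app a x = (f j).app a y) → x = y) :
    IsFinDimModule k A N := by
  have key : ∀ (a : A), Function.Injective
      (LinearMap.pi fun j => ((f j).app a).hom : N.obj a →ₗ[k] ∀ j, (M j).obj a) := by
    intro a x y h
    exact hf a x y fun j => congrFun h j
  have nat : ∀ j {a b : A} (g : a ⟶ b) (x : N.obj a),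
      (f j).app b (N.map g x) = (M j).map g ((f j).app a x) := fun j a b g x =>
    NatTrans.naturality_apply (f j) g x
  refine ⟨?_, ?_, ?_, ?_⟩
  · intro a b g h
    ext x
    refine hf b _ _ fun j => ?_
    rw [nat, (hM j).map_add]
    simp [nat]
  · intro a b c g
    ext x
    refine hf b _ _ fun j => ?_
    rw [nat, (hM j).map_smul]
    simp [nat]
  · intro a
    have := fun j => (hM j).finite_obj a
    exact Module.Finite.of_injective _ (key a)
  · refine (Set.finite_iUnion fun j => (hM j).finite_support).subset ?_
    intro a ha
    simp only [Set.mem_ofPred_eq, Set.mem_iUnion] at ha ⊢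
    by_contra! hn
    obtain ⟨x, y, hxy⟩ := ha
    exact hxy (hf a x y fun j => (hn j).elim _ _)

instance : (finDimModule k A).IsClosedUnderSubobjects where
  prop_of_mono {N M} f hf hM := by
    refine IsFinDimModule.of_jointly_injective (fun _ : Unit => M) (fun _ => hM) (fun _ => f) ?_
    intro a x y h
    have : Mono (f.app a) := inferInstance
    exact (ModuleCat.mono_iff_injective (f.app a)).1 this (h ())

instance : (finDimModule k A).IsClosedUnderQuotients where
  prop_of_epi {M N} f hf hM := by
    have surj : ∀ a, Function.Surjective (f.app a) := fun a =>
      (ModuleCat.epi_iff_surjective (f.app a)).1 inferInstance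
    have nat : ∀ {a b : A} (g : a ⟶ b) (x : M.obj a),
        N.map g (f.app a x) = f.app b (M.map g x) := fun g x =>
      (NatTrans.naturality_apply f g x).symm
    refine ⟨?_, ?_, ?_, ?_⟩
    · intro a b g h
      ext y
      obtain ⟨x, rfl⟩ := surj a y
      rw [nat, hM.map_add]
      exact ((f.app b).hom.map_add _ _).trans
        (congrArg₂ (· + ·) (nat g x).symm (nat h x).symm)
    · intro a b c g
      ext y
      obtain ⟨x, rfl⟩ := surj a y
      rw [nat, hM.map_smul]
      exact ((f.app b).hom.map_smul _ _).trans (congrArg (c • ·) (nat g x).symm)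
    · intro a
      have := hM.finite_obj a
      exact Module.Finite.of_surjective (f.app a).hom (surj a)
    · refine hM.finite_support.subset ?_
      intro a ha
      exact @Function.Surjective.nontrivial _ _ ha _ (surj a)

instance : (finDimModule k A).IsClosedUnderFiniteProducts where
  isClosedUnderLimitsOfShape J _ := by
    refine ⟨?_⟩
    rintro N ⟨p⟩
    refine IsFinDimModule.of_jointly_injective (fun j : J => p.diag.obj ⟨j⟩)
      (fun j => p.prop_diag_obj ⟨j⟩) (fun j => p.π.app ⟨j⟩) ?_
    intro a x y h
    have hl := isLimitOfPreserves ((evaluation A (ModuleCat.{v} k)).obj a) p.isLimit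
    exact Concrete.isLimit_ext _ hl x y (fun j => h j.as)

instance : (finDimModule k A).ContainsZero where
  exists_zero := by
    obtain ⟨Z, hZ⟩ := (inferInstance : HasZeroObject (A ⥤ ModuleCat.{v} k))
    refine ⟨Z, hZ, ?_⟩
    refine IsFinDimModule.of_jointly_injective (J := Empty) (fun j => j.elim) (fun j => j.elim)
      (fun j => j.elim) ?_
    intro a x y _
    have := ModuleCat.subsingleton_of_isZero (hZ.obj a)
    exact Subsingleton.elim _ _

variable (k A)

/-- The global dimension of `A` is finite: the projective dimensions of all finite-dimensional
`A`-modules have a common finite bound. By the instances above, `mod A` is an abelian category. -/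
def HasFiniteGlobalDimension : Prop :=
  ∃ n : ℕ, ∀ M : FinMod k A, HasProjectiveDimensionLE M n

variable {k A}

/-- The dimension `∑ a, dim M(a)` of a finite-dimensional module. -/
noncomputable def FinMod.dim (M : FinMod k A) : ℕ :=
  ∑ᶠ a : A, Module.finrank k (M.obj.obj a)

end Modules

section Complexes

variable (k : Type w) [Field k] (A : Type u) [Category.{v} A] [Preadditive A] [Linear k A]

variable {k A} in
/-- A complex is minimal if the image of each differential is contained in the radical of its
target, the radical of a module being the intersection of its maximal submodules. -/
def IsMinimal (P : CochainComplex (FinMod k A) ℤ) : Prop :=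
  ∀ (i : ℤ) (N : Subobject (P.X (i + 1))), IsCoatom N → N.Factors (P.d i (i + 1))

/-- The minimal complexes of finitely generated projective modules concentrated in the degrees
`0, …, m`. Objects of `mod A` are finite-dimensional, so projective ones are finitely generated. -/
structure IsInCm (m : ℕ) (P : CochainComplex (FinMod k A) ℤ) : Prop where
  projective : ∀ i : ℤ, Projective (P.X i)
  minimal : IsMinimal P
  isZero : ∀ i : ℤ, i < 0 ∨ (m : ℤ) < i → IsZero (P.X i)

/-- The category `C_m(proj A)`, a full subcategory of the category of complexes. -/
abbrev Cm (m : ℕ) :=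
  ObjectProperty.FullSubcategory (C := CochainComplex (FinMod k A) ℤ) (IsInCm k A m)

variable {k A} in
/-- The dimension `∑_{i = 0}^m dim P^i` of an object of `C_m(proj A)`. -/
noncomputable def Cm.dim {m : ℕ} (P : Cm k A m) : ℕ :=
  ∑ i ∈ Finset.range (m + 1), FinMod.dim (P.obj.X (i : ℤ))

end Complexes

section Indecomposable

variable {C : Type u} [Category.{v} C] [Preadditive C]

/-- An object of a preadditive category is indecomposable if it is nonzero and in every
decomposition of it as a direct sum of two objects one of the summands is zero. The existence of
direct sums in the category is not presupposed. -/
def IsIndecomposable (X : C) : Prop :=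
  ¬ IsZero X ∧ ∀ (Y Z : C) (b : BinaryBicone Y Z), Nonempty b.IsBilimit → Nonempty (X ≅ b.pt) →
    IsZero Y ∨ IsZero Z

/-- If all direct sums exist, this is the usual notion. -/
theorem isIndecomposable_iff [HasBinaryBiproducts C] (X : C) :
    IsIndecomposable X ↔ Indecomposable X := by
  refine and_congr_right fun _ => ⟨fun h Y Z e => ?_, fun h Y Z b hb e => ?_⟩
  · exact h Y Z (BinaryBiproduct.bicone Y Z) ⟨BinaryBiproduct.isBilimit Y Z⟩ ⟨e⟩
  · exact h Y Z (e.some ≪≫ biprod.uniqueUpToIso Y Z hb.some)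

end Indecomposable

section Main

/-- `C_m(proj A)` is of strongly unbounded type: there is a strictly increasing sequence `d` of
natural numbers such that for each `i` there are infinitely many pairwise non-isomorphic
indecomposable objects of dimension `d i` in `C_m(proj A)`. -/
def IsStronglyUnbounded (k : Type w) [Field k] (A : Type u) [Category.{v} A] [Preadditive A]
    [Linear k A] (m : ℕ) : Prop :=
  ∃ d : ℕ → ℕ, StrictMono d ∧ ∀ i : ℕ, ∃ P : ℕ → Cm k A m,
    (∀ j, IsIndecomposable (P j) ∧ (P j).dim = d i) ∧
    Pairwise fun j l => IsEmpty (P j ≅ P l)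

variable (k : Type w) [Field k]
  {B : Type u} [Category.{v} B] [Preadditive B] [Linear k B]
  {A : Type u'} [Category.{v'} A] [Preadditive A] [Linear k A]

/-- A `k`-linear functor `F : B ⥤ A` is cleaving if the `k`-linear maps `B(b, b') → A(F b, F b')`
admit `k`-linear retractions `r b b'` that are natural in `b` and `b'`. -/
def IsCleaving (F : B ⥤ A) : Prop :=
  ∃ r : ∀ b b' : B, (F.obj b ⟶ F.obj b') →ₗ[k] (b ⟶ b'),
    (∀ (b b' : B) (f : b ⟶ b'), r b b' (F.map f) = f) ∧
    (∀ (b₁ b b' b₁' : B) (f : b₁ ⟶ b) (g : F.obj b ⟶ F.obj b') (h : b' ⟶ b₁'),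
      r b₁ b₁' (F.map f ≫ g ≫ F.map h) = f ≫ r b b' g ≫ h)

end Main

end CleavingFunctors

/-! Induce and restrict along `F`. Choose each term of P in C_m(proj B) as a summand of a finite sum
of representables B(b, -), and send these to A(Fb, -). This gives a complex Q of projective
A-modules with dim Q ≤ N · dim P, where N bounds the dimensions of the representable A-modules. A
cleaving functor reflects isomorphisms. Between representables whose objects have local endomorphism
rings, radical means non-invertible, so Q is again minimal. The retraction of `F` splits the unit of
induction, so P is a direct summand of the restriction of Q (`exists_retract_restrictComplex`).

If P is indecomposable, its endomorphism ring is local, so P is already a summand of the restriction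
of some indecomposable summand Q' of Q (`exists_indecomposable_retract`). Then dim P ≤ |B| · dim Q'
(`dim_le_of_retract_restrictComplex`), so the dimensions of P and Q' bound each other linearly.

The restriction of a fixed complex has finite-dimensional endomorphism algebra, and hence only
finitely many isomorphism classes of summands with local endomorphism ring (`finite_of_retracts`).
Thus P ↦ Q' is finite-to-one on isomorphism classes. Infinitely many P of dimension d_i yield
infinitely many Q' of dimension at most N · d_i. The pigeonhole principle fixes one dimension e_i,
and e_i tends to infinity (`isStronglyUnbounded_of_bounds`). -/

namespace CleavingFunctors

/-! ### The Jacobson radical of a preadditive category. -/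

section Radical

variable {C : Type u} [Category.{v} C] [Preadditive C]

/-- Membership in the Jacobson radical of a preadditive category. -/
def IsRadical {X Y : C} (f : X ⟶ Y) : Prop :=
  ∀ g : Y ⟶ X, IsIso (𝟙 Y - g ≫ f)

/-- Jacobson's identity: if t inverts 1 - f ≫ g, then 1 + g ≫ t ≫ f inverts 1 - g ≫ f. -/
theorem isIso_one_sub_comp_swap {X Y : C} (f : X ⟶ Y) (g : Y ⟶ X) [IsIso (𝟙 X - f ≫ g)] :
    IsIso (𝟙 Y - g ≫ f) := by
  have h₁ : (𝟙 X - f ≫ g) ≫ inv (𝟙 X - f ≫ g) = 𝟙 X := IsIso.hom_inv_id _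
  have h₂ : inv (𝟙 X - f ≫ g) ≫ (𝟙 X - f ≫ g) = 𝟙 X := IsIso.inv_hom_id _
  generalize inv (𝟙 X - f ≫ g) = t at h₁ h₂
  rw [Preadditive.sub_comp, Category.id_comp, Category.assoc, sub_eq_iff_eq_add] at h₁
  rw [Preadditive.comp_sub, Category.comp_id, sub_eq_iff_eq_add] at h₂
  refine ⟨𝟙 Y + g ≫ t ≫ f, ?_, ?_⟩
  · have : g ≫ t ≫ f = g ≫ f + g ≫ f ≫ g ≫ t ≫ f := by
      nth_rw 1 [h₁]; simp
    simp only [Preadditive.sub_comp, Preadditive.comp_add, Category.id_comp, Category.comp_id,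
      Category.assoc]
    calc _ = 𝟙 Y + (g ≫ t ≫ f - (g ≫ f + g ≫ f ≫ g ≫ t ≫ f)) := by abel
      _ = 𝟙 Y := by rw [← this]; simp
  · have : g ≫ t ≫ f = g ≫ f + g ≫ t ≫ f ≫ g ≫ f := by
      nth_rw 1 [h₂]; simp
    simp only [Preadditive.comp_sub, Preadditive.add_comp, Category.id_comp, Category.comp_id,
      Category.assoc]
    rw [this]; abel

theorem IsRadical.comp_left {W X Y : C} {f : X ⟶ Y} (hf : IsRadical f) (h : W ⟶ X) :
    IsRadical (h ≫ f) := fun g => by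
  simpa using hf (g ≫ h)

theorem IsRadical.comp_right {X Y Z : C} {f : X ⟶ Y} (hf : IsRadical f) (h : Y ⟶ Z) :
    IsRadical (f ≫ h) := fun g => by
  have : IsIso (𝟙 Y - h ≫ g ≫ f) := by simpa using hf (h ≫ g)
  simpa using isIso_one_sub_comp_swap h (g ≫ f)

theorem isRadical_zero (X Y : C) : IsRadical (0 : X ⟶ Y) := fun g => by
  simp only [comp_zero, sub_zero]; infer_instance

theorem IsRadical.add {X Y : C} {f₁ f₂ : X ⟶ Y} (h₁ : IsRadical f₁) (h₂ : IsRadical f₂) :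
    IsRadical (f₁ + f₂) := fun g => by
  have := h₁ g
  have := h₂.comp_right (inv (𝟙 Y - g ≫ f₁)) g
  -- With u = 1 - g ≫ f₁ invertible, split off u on the right; the other factor is invertible
  -- because f₂ ≫ u⁻¹ is radical.
  have e : 𝟙 Y - g ≫ (f₁ + f₂) =
      (𝟙 Y - g ≫ f₂ ≫ inv (𝟙 Y - g ≫ f₁)) ≫ (𝟙 Y - g ≫ f₁) := by
    rw [Preadditive.sub_comp, Category.assoc, Category.assoc, IsIso.inv_hom_id,
      Preadditive.comp_add]
    simp only [Category.id_comp, Category.comp_id]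
    abel
  rw [e]
  infer_instance

theorem IsRadical.sum {X Y : C} {J : Type*} (s : Finset J) (f : J → (X ⟶ Y))
    (h : ∀ j ∈ s, IsRadical (f j)) : IsRadical (∑ j ∈ s, f j) := by
  classical
  induction s using Finset.induction_on with
  | empty => simpa using isRadical_zero X Y
  | insert a s ha ih =>
    rw [Finset.sum_insert ha]
    exact (h a (by simp)).add (ih fun j hj => h j (by simp [hj]))

end Radical

/-! ### Local endomorphism rings. -/

section Local

variable {C : Type u} [Category.{v} C] [Preadditive C]

theorem isIso_or_isIso_of_add_eq_id {X : C} [IsLocalRing (End X)] {f g : X ⟶ X}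
    (h : f + g = 𝟙 X) : IsIso f ∨ IsIso g := by
  have h' : (show End X from f) + (show End X from g) = 1 := h
  rw [← isUnit_iff_isIso, ← isUnit_iff_isIso]
  exact IsLocalRing.isUnit_or_isUnit_of_add_one h'

/-- A split monomorphism from a nonzero object to an object with local endomorphism ring is an
isomorphism. -/
theorem isIso_of_isIso_comp {X Y : C} [IsLocalRing (End Y)] (hX : ¬ IsZero X)
    (f : X ⟶ Y) (g : Y ⟶ X) [IsIso (f ≫ g)] : IsIso f := by
  have hsplit : f ≫ g ≫ inv (f ≫ g) = 𝟙 X := by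
    rw [← Category.assoc, IsIso.hom_inv_id]
  generalize g ≫ inv (f ≫ g) = g' at hsplit
  -- The idempotent g' ≫ f is 1 if it is invertible, and 0 if its complement is; the latter would
  -- force X = 0.
  have he : (g' ≫ f) ≫ (g' ≫ f) = g' ≫ f := by
    rw [Category.assoc, reassoc_of% hsplit]
  rcases isIso_or_isIso_of_add_eq_id (add_sub_cancel (g' ≫ f) (𝟙 Y)) with h | h
  · refine ⟨g', hsplit, ?_⟩
    rw [← cancel_epi (g' ≫ f), he, Category.comp_id]
  · exfalso
    have h0 : g' ≫ f = 0 := by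
      rw [← cancel_epi (𝟙 Y - g' ≫ f), Preadditive.sub_comp, he]
      simp
    apply hX
    rw [IsZero.iff_id_eq_zero, ← hsplit, ← Category.comp_id (f ≫ g'), ← hsplit, Category.assoc,
      reassoc_of% h0]
    simp

theorem isIso_id_sub_of_not_isIso {X : C} [IsLocalRing (End X)] {f : X ⟶ X} (h : ¬ IsIso f) :
    IsIso (𝟙 X - f) :=
  (isIso_or_isIso_of_add_eq_id (add_sub_cancel f (𝟙 X))).resolve_left h

/-- A finite-dimensional algebra whose only idempotents are `0` and `1` is local. -/
theorem isLocalRing_of_idempotents (k : Type w) [Field k] (R : Type v) [Ring R] [Algebra k R]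
    [Module.Finite k R] [Nontrivial R] (h : ∀ e : R, e * e = e → e = 0 ∨ e = 1) :
    IsLocalRing R := by
  refine IsLocalRing.of_isUnit_or_isUnit_one_sub_self fun f => ?_
  have hint : IsIntegral k f := Algebra.IsIntegral.isIntegral f
  -- Fitting's lemma: the minimal polynomial is X^n q with q(0) ≠ 0, and the Bézout relation for
  -- X^(n+1) and q gives an idempotent at f. If it is 0, f is nilpotent; if it is 1, f is a unit.
  -- The exponent n + 1 leaves a factor X to pull out even when n = 0.
  obtain ⟨q, hq, hq0⟩ := Polynomial.exists_eq_pow_rootMultiplicity_mul_and_not_dvd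
    (minpoly k f) (minpoly.ne_zero hint) 0
  generalize Polynomial.rootMultiplicity 0 (minpoly k f) = n at hq
  rw [Polynomial.C_0, sub_zero] at hq hq0
  have hcop : IsCoprime ((Polynomial.X : Polynomial k) ^ (n + 1)) q :=
    ((Polynomial.prime_X.irreducible.coprime_iff_not_dvd).2 hq0).pow_left
  have hz : Polynomial.aeval f (Polynomial.X ^ (n + 1) * q) = 0 := by
    rw [pow_succ', mul_assoc, ← hq, map_mul, minpoly.aeval k f, mul_zero]
  obtain ⟨a, b, hab⟩ := hcop
  have hidem : Polynomial.aeval f (a * Polynomial.X ^ (n + 1)) *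
      Polynomial.aeval f (a * Polynomial.X ^ (n + 1)) =
        Polynomial.aeval f (a * Polynomial.X ^ (n + 1)) := by
    have e : (a * Polynomial.X ^ (n + 1)) * (a * Polynomial.X ^ (n + 1)) =
        a * Polynomial.X ^ (n + 1) - (a * b) * (Polynomial.X ^ (n + 1) * q) := by
      linear_combination (a * Polynomial.X ^ (n + 1)) * hab
    rw [← map_mul, e, map_sub, map_mul _ (a * b), hz, mul_zero, sub_zero]
  rcases h _ hidem with h0 | h1
  · right
    have hb : Polynomial.aeval f (b * q) = 1 := by
      have := congrArg (Polynomial.aeval f) hab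
      rwa [map_add, h0, zero_add, map_one] at this
    have hn : f ^ (n + 1) = 0 := by
      have e : Polynomial.X ^ (n + 1) * (b * q) = b * (Polynomial.X ^ (n + 1) * q) := by ring
      have := congrArg (Polynomial.aeval f) e
      rw [map_mul, hb, map_mul, hz] at this
      simpa using this
    exact IsNilpotent.isUnit_one_sub ⟨n + 1, hn⟩
  · left
    refine ⟨⟨f, Polynomial.aeval f (a * Polynomial.X ^ n), ?_, ?_⟩, rfl⟩
    · rw [← h1]
      nth_rw 1 [← Polynomial.aeval_X (R := k) f]
      rw [← map_mul]
      congr 1; ring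
    · rw [← h1]
      nth_rw 2 [← Polynomial.aeval_X (R := k) f]
      rw [← map_mul]
      congr 1; ring

end Local

/-! ### Counting summands with local endomorphism rings. -/

section Counting

variable {C : Type u} [Category.{v} C] [Preadditive C]

theorem not_isIso_comp_of_not_iso {P Q : C} [IsLocalRing (End Q)] (hP : ¬ IsZero P)
    (h : IsEmpty (P ≅ Q)) (f : P ⟶ Q) (g : Q ⟶ P) : ¬ IsIso (f ≫ g) := fun _ => by
  have := isIso_of_isIso_comp hP f g
  exact h.false (asIso f)

theorem not_isZero_of_isLocalRing_end {P : C} [IsLocalRing (End P)] : ¬ IsZero P := fun h =>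
  one_ne_zero (α := End P) (h.eq_of_src _ _)

variable (k : Type w) [Field k] [Linear k C]

/-- Pairwise non-isomorphic objects with local endomorphism rings whose identities factor through a
given endomorphism `E` of `X`, up to isomorphism: their number is bounded by the rank of `E`. -/
theorem card_le_finrank_range {X : C} [Module.Finite k (X ⟶ X)] (n : ℕ) :
    ∀ (P : Fin n → C) (i : ∀ j, P j ⟶ X) (p : ∀ j, X ⟶ P j) (E : X ⟶ X),
      (∀ j, IsLocalRing (End (P j))) → (∀ j, IsIso (i j ≫ E ≫ p j)) →
      (Pairwise fun j l => IsEmpty (P j ≅ P l)) →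
      n ≤ Module.finrank k (LinearMap.range (Linear.rightComp k X E)) := by
  induction n with
  | zero => intros; exact Nat.zero_le _
  | succ n ih =>
    intro P i p E hloc hiso hpair
    have hz : ∀ j, ¬ IsZero (P j) := fun j => not_isZero_of_isLocalRing_end
    let t : P 0 ⟶ P 0 := inv (i 0 ≫ E ≫ p 0)
    -- Gaussian elimination: split P 0 off E. The rank drops because everything in the new range is
    -- killed by p 0, whereas p 0 ≫ i 0 ≫ E, in the old range, is not.
    let E' : X ⟶ X := E - E ≫ p 0 ≫ t ≫ i 0 ≫ E
    have hE' : E' ≫ p 0 = 0 := by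
      have : t ≫ i 0 ≫ E ≫ p 0 = 𝟙 _ := IsIso.inv_hom_id _
      simp only [E', Preadditive.sub_comp, Category.assoc, this, Category.comp_id, sub_self]
    have key := ih (fun j => P j.succ) (fun j => i j.succ) (fun j => p j.succ) E'
      (fun j => hloc _) (fun j => ?_) (fun j l hjl => hpair (by simpa using hjl))
    · refine Nat.succ_le_of_lt (lt_of_le_of_lt key (Submodule.finrank_lt_finrank_of_lt ?_))
      refine lt_of_le_of_ne ?_ fun heq => ?_
      · rintro _ ⟨f, rfl⟩
        refine ⟨f - f ≫ E ≫ p 0 ≫ t ≫ i 0, ?_⟩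
        simp [E']
      · have hmem : (p 0 ≫ i 0) ≫ E ∈ LinearMap.range (Linear.rightComp k X E') := by
          rw [heq]; exact ⟨p 0 ≫ i 0, rfl⟩
        obtain ⟨f, hf⟩ := hmem
        have h0 : (p 0 ≫ i 0 ≫ E ≫ p 0) = 0 := by
          have := congrArg (· ≫ p 0) hf
          simpa [hE'] using this.symm
        apply hz 0
        have h1 : p 0 = 0 := by
          rw [← cancel_mono (i 0 ≫ E ≫ p 0), h0, zero_comp]
        have h2 := hiso 0
        rw [h1] at h2
        rw [IsZero.iff_id_eq_zero, ← cancel_mono (i 0 ≫ E ≫ (0 : X ⟶ P 0))]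
        simp
    -- The correction to i ≫ E ≫ p at a later index factors through the non-isomorphic object P 0,
    -- so it is a non-unit in a local ring and does not destroy invertibility.
    · have hnot : ¬ IsIso ((i j.succ ≫ E ≫ p 0) ≫ (t ≫ i 0 ≫ E ≫ p j.succ)) :=
        not_isIso_comp_of_not_iso (hz _) (hpair (Fin.succ_ne_zero j)) _ _
      have := hiso j.succ
      have e : i j.succ ≫ E' ≫ p j.succ = (𝟙 _ - ((i j.succ ≫ E ≫ p 0) ≫
          (t ≫ i 0 ≫ E ≫ p j.succ)) ≫ inv (i j.succ ≫ E ≫ p j.succ)) ≫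
            (i j.succ ≫ E ≫ p j.succ) := by
        simp only [Preadditive.sub_comp, Category.id_comp, Category.assoc, IsIso.inv_hom_id,
          Category.comp_id, E', Preadditive.comp_sub]
      rw [e]
      have h3 : IsIso (𝟙 _ - ((i j.succ ≫ E ≫ p 0) ≫
          (t ≫ i 0 ≫ E ≫ p j.succ)) ≫ inv (i j.succ ≫ E ≫ p j.succ)) := by
        have := hloc j.succ
        refine isIso_id_sub_of_not_isIso fun h => hnot ?_
        exact IsIso.of_isIso_comp_right _ (inv (i j.succ ≫ E ≫ p j.succ))
      infer_instance

/-- An object with finite-dimensional endomorphism algebra has at most finitely many isomorphism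
classes of retracts with local endomorphism rings. -/
theorem finite_of_retracts {X : C} [Module.Finite k (X ⟶ X)] {J : Type*} (P : J → C)
    (hloc : ∀ j, IsLocalRing (End (P j))) (hret : ∀ j, Nonempty (Retract (P j) X))
    (hpair : Pairwise fun j l => IsEmpty (P j ≅ P l)) : Finite J := by
  by_contra hJ
  rw [not_finite_iff_infinite] at hJ
  let e := Infinite.natEmbedding J
  let n := Module.finrank k (LinearMap.range (Linear.rightComp k X (𝟙 X))) + 1
  have := card_le_finrank_range k n (X := X) (fun j => P (e j))
    (fun j => (hret (e j)).some.i) (fun j => (hret (e j)).some.r) (𝟙 X) (fun j => hloc _)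
    (fun j => by simp only [Category.id_comp, Retract.retract]; infer_instance)
    (fun j l hjl => hpair fun h => hjl (Fin.ext (e.injective h)))
  omega

end Counting

/-! ### Finiteness of Hom spaces, and the radical of a module against the radical of the category.
-/

section FiniteDimensional

variable {k : Type w} [Field k] {A : Type u} [Category.{v} A] [Preadditive A] [Linear k A]

theorem subobject_le_iff_range {Y : FinMod k A} (N M : Subobject Y) :
    N ≤ M ↔ ∀ a, LinearMap.range (N.arrow.hom.app a).hom ≤
      LinearMap.range (M.arrow.hom.app a).hom := by
  constructor
  · intro h a
    rintro _ ⟨x, rfl⟩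
    refine ⟨(Subobject.ofLE N M h).hom.app a x, ?_⟩
    have := Subobject.ofLE_arrow h
    conv_rhs => rw [← this]
    rfl
  · intro h
    have h0 : N.arrow ≫ cokernel.π M.arrow = 0 := by
      ext a x
      obtain ⟨y, hy⟩ := h a ⟨x, rfl⟩
      change (cokernel.π M.arrow).hom.app a (N.arrow.hom.app a x) = 0
      have h1 := congrArg (fun f => f.hom.app a y) (cokernel.condition M.arrow)
      change (cokernel.π M.arrow).hom.app a (M.arrow.hom.app a y) = 0 at h1
      rw [← h1]
      exact congrArg _ hy.symm
    exact Subobject.le_of_factors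
      ((Subobject.factors_iff _ _).2 ⟨Abelian.monoLift M.arrow N.arrow h0, by
        exact Abelian.monoLift_comp M.arrow N.arrow h0⟩)

/-- Subobjects embed, as an ordered set, into the subspaces of the finite-dimensional space ∏ Y(a).
Consequently every proper submodule lies in a maximal one. -/
instance wellFoundedGT_subobject [Finite A] (Y : FinMod k A) : WellFoundedGT (Subobject Y) := by
  classical
  have := Y.property.finite_obj
  let f : Subobject Y → Submodule k (∀ a, Y.obj.obj a) := fun N =>
    Submodule.pi Set.univ fun a => LinearMap.range (N.arrow.hom.app a).hom
  have hf : ∀ N M, f N ≤ f M ↔ N ≤ M := by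
    intro N M
    rw [subobject_le_iff_range]
    constructor
    · intro h a x hx
      have : Pi.single a x ∈ f N := by
        intro b _
        rcases eq_or_ne b a with rfl | hb
        · simpa using hx
        · simp [Pi.single_eq_of_ne hb]
      simpa using h this a trivial
    · intro h x hx a ha
      exact h a (hx a ha)
  exact StrictMono.wellFoundedGT (f := f) fun N M h =>
    lt_of_le_not_ge ((hf _ _).2 h.le) fun h' => h.not_ge ((hf _ _).1 h')

instance finite_hom_functor [Finite A] {C : Type u'} [Category.{v'} C] [Preadditive C] [Linear k C]
    (M N : A ⥤ C) [∀ a, Module.Finite k (M.obj a ⟶ N.obj a)] : Module.Finite k (M ⟶ N) := by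
  let f : (M ⟶ N) →ₗ[k] ∀ a, (M.obj a ⟶ N.obj a) :=
    { toFun := fun g a => g.app a
      map_add' := fun _ _ => rfl
      map_smul' := fun _ _ => rfl }
  exact Module.Finite.of_injective f fun g h e => by
    ext1
    funext a
    exact congrFun e a

instance finite_hom_moduleCat (M N : ModuleCat.{v} k) [Module.Finite k M] [Module.Finite k N] :
    Module.Finite k (M ⟶ N) :=
  Module.Finite.equiv (ModuleCat.homLinearEquiv (S := k) (M := M) (N := N)).symm

instance finite_hom_finMod [Finite A] (M N : FinMod k A) : Module.Finite k (M ⟶ N) := by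
  have := M.property.finite_obj
  have := N.property.finite_obj
  let f : (M ⟶ N) →ₗ[k] (M.obj ⟶ N.obj) :=
    { toFun := fun g => g.hom
      map_add' := fun _ _ => rfl
      map_smul' := fun _ _ => rfl }
  exact Module.Finite.of_injective f fun g h e => ObjectProperty.hom_ext _ e

theorem finite_hom_complex {C : Type u'} [Category.{v'} C] [Preadditive C] [Linear k C]
    (X Y : CochainComplex C ℤ) [∀ i, Module.Finite k (X.X i ⟶ Y.X i)] (s : Finset ℤ)
    (hs : ∀ i ∉ s, IsZero (X.X i)) : Module.Finite k (X ⟶ Y) := by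
  let f : (X ⟶ Y) →ₗ[k] ∀ i : s, (X.X i ⟶ Y.X i) :=
    { toFun := fun g a => g.f a
      map_add' := fun _ _ => rfl
      map_smul' := fun _ _ => rfl }
  refine Module.Finite.of_injective f fun g h e => ?_
  ext i
  by_cases hi : i ∈ s
  · exact congrFun e ⟨i, hi⟩
  · exact (hs i hi).eq_of_src _ _

/-- Precomposition with an epimorphism is injective on the finite-dimensional endomorphism algebra,
hence surjective. -/
theorem isIso_of_epi_end {C : Type u'} [Category.{v'} C] [Preadditive C] [Linear k C]
    {X : C} [Module.Finite k (X ⟶ X)] (f : X ⟶ X) [Epi f] : IsIso f := by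
  have hinj : Function.Injective (Linear.leftComp k X f) := fun g h e => (cancel_epi f).1 e
  obtain ⟨g, hg⟩ := LinearMap.surjective_of_injective hinj (𝟙 X)
  have hg : f ≫ g = 𝟙 X := hg
  refine ⟨g, hg, ?_⟩
  rw [← cancel_epi f, reassoc_of% hg, Category.comp_id]

/-- If 1 - g ≫ f is not invertible, it is not epi, so its image lies in a maximal submodule N. Since
g ≫ f also lands in N, so does the identity, a contradiction. -/
theorem isRadical_of_forall_isCoatom [Finite A] {X Y : FinMod k A} (f : X ⟶ Y)
    (hf : ∀ N : Subobject Y, IsCoatom N → N.Factors f) : IsRadical f := by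
  intro g
  by_contra hg
  have hepi : ¬ Epi (𝟙 Y - g ≫ f) := fun h => hg (isIso_of_epi_end (k := k) _)
  have hne : kernelSubobject (cokernel.π (𝟙 Y - g ≫ f)) ≠ ⊤ := by
    intro h
    apply hepi
    rw [Preadditive.epi_iff_cancel_zero]
    intro Z t ht
    have h1 : (kernelSubobject (cokernel.π (𝟙 Y - g ≫ f))).Factors (𝟙 Y) := by
      rw [h]; exact Subobject.top_factors _
    rw [kernelSubobject_factors_iff, Category.id_comp] at h1
    rw [← cokernel.π_desc _ t ht, h1, zero_comp]
  have hco : IsCoatomic (Subobject Y) := inferInstance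
  obtain ⟨N, hN, hle⟩ := (eq_top_or_exists_le_coatom
    (kernelSubobject (cokernel.π (𝟙 Y - g ≫ f)))).resolve_left hne
  have h1 : N.Factors (𝟙 Y - g ≫ f) := Subobject.factors_of_le _ hle
    (kernelSubobject_factors _ _ (cokernel.condition _))
  have h2 : N.Factors (g ≫ f) := Subobject.factors_of_factors_right g (hf N hN)
  have h3 := Subobject.factors_add _ _ h1 h2
  rw [sub_add_cancel] at h3
  refine hN.1 (top_le_iff.1 (Subobject.le_of_factors ?_))
  simpa using Subobject.factors_of_factors_right (⊤ : Subobject Y).arrow h3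

/-- If f misses a maximal N, then f followed by Y → Y/N is epi. Projectivity lifts the quotient map
through it to some g, and 1 - g ≫ f then kills the quotient map although it is invertible. -/
theorem IsRadical.factors_of_isCoatom {X Y : FinMod k A} [Projective Y] {f : X ⟶ Y}
    (hf : IsRadical f) (N : Subobject Y) (hN : IsCoatom N) : N.Factors f := by
  by_contra hNf
  have hfac : ∀ {W : FinMod k A} (t : W ⟶ Y), t ≫ cokernel.π N.arrow = 0 → N.Factors t :=
    fun t ht => (Subobject.factors_iff _ _).2 ⟨Abelian.monoLift N.arrow t ht,
      Abelian.monoLift_comp N.arrow t ht⟩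
  have hepi : Epi (f ≫ cokernel.π N.arrow) := by
    rw [Preadditive.epi_iff_cancel_zero]
    intro Z t ht
    have hle : N ≤ kernelSubobject (cokernel.π N.arrow ≫ t) := by
      apply Subobject.le_of_factors
      apply kernelSubobject_factors
      rw [← Category.assoc, cokernel.condition, zero_comp]
    have hne : kernelSubobject (cokernel.π N.arrow ≫ t) ≠ N := by
      intro h
      apply hNf
      rw [← h]
      apply kernelSubobject_factors
      simpa using ht
    have htop := hN.2 _ (lt_of_le_of_ne hle hne.symm)
    have h1 : (kernelSubobject (cokernel.π N.arrow ≫ t)).Factors (𝟙 Y) := by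
      rw [htop]; exact Subobject.top_factors _
    rw [kernelSubobject_factors_iff, Category.id_comp] at h1
    rw [← cancel_epi (cokernel.π N.arrow), h1, comp_zero]
  let g := Projective.factorThru (cokernel.π N.arrow) (f ≫ cokernel.π N.arrow)
  have hg : g ≫ f ≫ cokernel.π N.arrow = cokernel.π N.arrow := Projective.factorThru_comp _ _
  have := hf g
  have h0 : cokernel.π N.arrow = 0 := by
    rw [← cancel_epi (𝟙 Y - g ≫ f), Preadditive.sub_comp, Category.assoc, hg]
    simp
  refine hN.1 (top_le_iff.1 (Subobject.le_of_factors ?_))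
  exact hfac _ (by rw [h0, comp_zero])

/-- Replaces maximal submodules by an ideal of morphisms, which visibly passes to retracts and can
be tested on matrix entries. -/
theorem isMinimal_iff [Finite A] (P : CochainComplex (FinMod k A) ℤ)
    (hP : ∀ i, Projective (P.X i)) :
    IsMinimal P ↔ ∀ i, IsRadical (P.d i (i + 1)) :=
  ⟨fun h i => isRadical_of_forall_isCoatom _ (h i),
    fun h i N hN => have := hP (i + 1); (h i).factors_of_isCoatom N hN⟩

end FiniteDimensional

/-! ### C_m(proj A) has split idempotents and finite-dimensional Hom spaces. -/

section Cm

variable {k : Type w} [Field k] {A : Type u} [Category.{v} A] [Preadditive A] [Linear k A]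

theorem IsInCm.of_retract [Finite A] {m : ℕ} {P Q : CochainComplex (FinMod k A) ℤ}
    (hQ : IsInCm k A m Q) (h : Retract P Q) : IsInCm k A m P := by
  have hret : ∀ i, h.i.f i ≫ h.r.f i = 𝟙 _ := fun i => by
    rw [← HomologicalComplex.comp_f, h.retract, HomologicalComplex.id_f]
  have hproj : ∀ i, Projective (P.X i) := fun i =>
    have := hQ.projective i
    Retract.projective (⟨h.i.f i, h.r.f i, hret i⟩ : Retract (P.X i) (Q.X i))
  refine ⟨hproj, (isMinimal_iff P hproj).2 fun i => ?_, fun i hi => ?_⟩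
  · have := (((isMinimal_iff Q hQ.projective).1 hQ.minimal i).comp_left (h.i.f i)).comp_right
      (h.r.f (i + 1))
    rwa [h.i.comm, Category.assoc, hret, Category.comp_id] at this
  · rw [IsZero.iff_id_eq_zero, ← hret, (hQ.isZero i hi).eq_of_tgt (h.i.f i) 0, zero_comp]

instance isIdempotentComplete_cm [Finite A] (m : ℕ) : IsIdempotentComplete (Cm k A m) where
  idempotents_split X p hp := by
    obtain ⟨Y, i, e, hi, he⟩ := IsIdempotentComplete.idempotents_split X.obj p.hom
      (congrArg (·.hom) hp)
    exact ⟨⟨Y, X.property.of_retract ⟨i, e, hi⟩⟩, ObjectProperty.homMk i, ObjectProperty.homMk e,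
      ObjectProperty.hom_ext _ hi, ObjectProperty.hom_ext _ he⟩

instance finite_hom_cm [Finite A] {m : ℕ} (P Q : Cm k A m) : Module.Finite k (P ⟶ Q) := by
  have := finite_hom_complex (k := k) P.obj Q.obj (Finset.Icc 0 (m : ℤ)) fun i hi =>
    P.property.isZero i (by rw [Finset.mem_Icc] at hi; omega)
  let f : (P ⟶ Q) →ₗ[k] (P.obj ⟶ Q.obj) :=
    { toFun := fun g => g.hom
      map_add' := fun _ _ => rfl
      map_smul' := fun _ _ => rfl }
  exact Module.Finite.of_injective f fun g h e => ObjectProperty.hom_ext _ e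

/-- By finite-dimensionality it suffices to treat idempotents. Splitting e and 1 - e exhibits X as a
direct sum, and the vanishing of a summand makes e equal to 0 or 1. -/
theorem IsIndecomposable.isLocalRing_end {C : Type u'} [Category.{v'} C] [Preadditive C]
    [IsIdempotentComplete C] (k : Type w) [Field k] [Linear k C] {X : C}
    [Module.Finite k (X ⟶ X)] (hX : IsIndecomposable X) : IsLocalRing (End X) := by
  have : Module.Finite k (End X) := inferInstanceAs (Module.Finite k (X ⟶ X))
  have : Nontrivial (End X) := ⟨⟨1, 0, fun h => hX.1 ((IsZero.iff_id_eq_zero X).2 h)⟩⟩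
  refine isLocalRing_of_idempotents k (End X) fun (e : X ⟶ X) (he : e ≫ e = e) => ?_
  obtain ⟨Y, i, p, hi, hp⟩ := IsIdempotentComplete.idempotents_split X e he
  obtain ⟨Z, j, q, hj, hq⟩ := IsIdempotentComplete.idempotents_split X (𝟙 X - e) (by
    simp only [Preadditive.sub_comp, Preadditive.comp_sub, Category.id_comp, Category.comp_id, he]
    abel)
  have hjp : j ≫ p = 0 := by
    have h1 : (j ≫ q) ≫ j ≫ (p ≫ i) ≫ p = 0 := by
      have : q ≫ j ≫ p ≫ i = 0 := by
        rw [← Category.assoc, hq, hp, Preadditive.sub_comp, he, Category.id_comp, sub_self]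
      simp only [Category.assoc, reassoc_of% this, zero_comp, comp_zero]
    rw [hj] at h1
    simpa [hi] using h1
  have hiq : i ≫ q = 0 := by
    have h1 : (i ≫ p) ≫ i ≫ (q ≫ j) ≫ q = 0 := by
      have : p ≫ i ≫ q ≫ j = 0 := by
        rw [← Category.assoc, hq, hp, Preadditive.comp_sub, he, Category.comp_id, sub_self]
      simp only [Category.assoc, reassoc_of% this, zero_comp, comp_zero]
    rw [hi] at h1
    simpa [hj] using h1
  let b : BinaryBicone Y Z :=
    { pt := X, fst := p, snd := q, inl := i, inr := j, inl_fst := hi, inr_snd := hj,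
      inl_snd := hiq, inr_fst := hjp }
  have hb : b.IsBilimit := isBinaryBilimitOfTotal b (by
    change p ≫ i + q ≫ j = 𝟙 X
    rw [hp, hq, add_sub_cancel])
  rcases hX.2 Y Z b ⟨hb⟩ ⟨Iso.refl X⟩ with h | h
  · left
    change e = 0
    rw [← hp, h.eq_of_src i 0, comp_zero]
  · right
    change e = 𝟙 X
    rw [h.eq_of_src j 0, comp_zero] at hq
    exact (sub_eq_zero.1 hq.symm).symm

end Cm

/-! ### Finite direct sums of representable modules. -/

section Free

variable {k : Type w} [Field k] {A : Type u} [Category.{v} A] [Preadditive A] [Linear k A]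

theorem FinMod.hom_ext_apply {M N : FinMod k A} {f g : M ⟶ N}
    (h : ∀ (a : A) (x : M.obj.obj a), f.hom.app a x = g.hom.app a x) : f = g := by
  ext a x
  exact h a x

theorem FinMod.comp_apply {M N L : FinMod k A} (f : M ⟶ N) (g : N ⟶ L) (a : A)
    (x : M.obj.obj a) : (f ≫ g).hom.app a x = g.hom.app a (f.hom.app a x) := rfl

theorem FinMod.naturality_apply {M N : FinMod k A} (f : M ⟶ N) {a b : A} (g : a ⟶ b)
    (x : M.obj.obj a) : f.hom.app b (M.obj.map g x) = N.obj.map g (f.hom.app a x) :=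
  NatTrans.naturality_apply f.hom g x

theorem FinMod.map_sum {M : FinMod k A} {a b : A} {J : Type*} (s : Finset J) (g : J → (a ⟶ b))
    (x : M.obj.obj a) : M.obj.map (∑ j ∈ s, g j) x = ∑ j ∈ s, M.obj.map (g j) x := by
  classical
  have h0 : M.obj.map (0 : a ⟶ b) = 0 := by
    have := M.property.map_add (0 : a ⟶ b) 0
    simpa using this
  induction s using Finset.induction_on with
  | empty => simp [h0]
  | insert j s hj ih =>
    rw [Finset.sum_insert hj, Finset.sum_insert hj, M.property.map_add, ← ih]
    rfl

theorem FinMod.surjective_app_of_epi {M N : FinMod k A} (f : M ⟶ N) [Epi f] (a : A) :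
    Function.Surjective (f.hom.app a) := by
  have := (finDimModule k A).preservesEpimorphisms_ι_of_isNormalMonoCategory
  have h : Epi ((finDimModule k A).ι.map f) := inferInstance
  have : Epi (f.hom.app a) := (NatTrans.epi_iff_epi_app f.hom).1 h a
  exact (ModuleCat.epi_iff_surjective _).1 this

theorem FinMod.epi_of_surjective_app {M N : FinMod k A} (f : M ⟶ N)
    (h : ∀ a, Function.Surjective (f.hom.app a)) : Epi f := by
  refine ⟨fun g g' e => FinMod.hom_ext_apply fun a x => ?_⟩
  obtain ⟨y, rfl⟩ := h a x
  rw [← FinMod.comp_apply, e, FinMod.comp_apply]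

theorem FinMod.dim_eq_sum [Fintype A] (M : FinMod k A) :
    M.dim = ∑ a, Module.finrank k (M.obj.obj a) :=
  finsum_eq_sum_of_fintype _

variable (k) in
/-- The direct sum of the representable functors `A(b j, -)`. -/
def freeFunctor {n : ℕ} (b : Fin n → A) : A ⥤ ModuleCat.{v} k where
  obj x := ModuleCat.of k (∀ j, b j ⟶ x)
  map f := ModuleCat.ofHom (LinearMap.pi fun j =>
    (Linear.rightComp k (b j) f).comp (LinearMap.proj j))
  map_id _ := ModuleCat.hom_ext (LinearMap.ext fun _ => funext fun _ => Category.comp_id _)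
  map_comp _ _ := ModuleCat.hom_ext (LinearMap.ext fun _ => funext fun _ =>
    (Category.assoc _ _ _).symm)

variable [Finite A] [∀ a b : A, Module.Finite k (a ⟶ b)]

variable (k) in
/-- The direct sum of the representable modules `A(b j, -)`. -/
def free {n : ℕ} (b : Fin n → A) : FinMod k A where
  obj := freeFunctor k b
  property :=
    { map_add := fun _ _ => ModuleCat.hom_ext (LinearMap.ext fun _ => funext fun _ =>
        Preadditive.comp_add _ _ _ _ _ _)
      map_smul := fun _ _ => ModuleCat.hom_ext (LinearMap.ext fun _ => funext fun _ =>
        Linear.comp_smul _ _ _ _ _ _)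
      finite_obj := fun a => inferInstanceAs (Module.Finite k (∀ j, b j ⟶ a))
      finite_support := Set.toFinite _ }

variable {n : ℕ} {b : Fin n → A}

/-- The generators of a free module. -/
def free.gen (b : Fin n → A) (j : Fin n) : (free k b).obj.obj (b j) :=
  (Pi.single j (𝟙 (b j)) : ∀ l, b l ⟶ b j)

theorem free.eq_sum {x : A} (g : ∀ j, b j ⟶ x) :
    (show (free k b).obj.obj x from g) = ∑ j, (free k b).obj.map (g j) (free.gen b j) := by
  change g = ∑ j, fun l => (Pi.single j (𝟙 (b j)) : ∀ l, b l ⟶ b j) l ≫ g j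
  funext l
  rw [Finset.sum_apply, Finset.sum_eq_single l]
  · simp
  · intro j _ hj
    rw [Pi.single_eq_of_ne hj.symm, zero_comp]
  · simp

theorem free.apply_eq_sum {M : FinMod k A} (f : free k b ⟶ M) {x : A} (g : ∀ j, b j ⟶ x) :
    f.hom.app x (show (free k b).obj.obj x from g) =
      ∑ j, M.obj.map (g j) (f.hom.app (b j) (free.gen b j)) := by
  refine ((congrArg (f.hom.app x) (free.eq_sum g)).trans (_root_.map_sum _ _ _)).trans ?_
  exact Finset.sum_congr rfl fun j _ => FinMod.naturality_apply f (g j) _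

theorem free.hom_ext {M : FinMod k A} {f g : free k b ⟶ M}
    (h : ∀ j, f.hom.app (b j) (free.gen b j) = g.hom.app (b j) (free.gen b j)) : f = g :=
  FinMod.hom_ext_apply fun a x => by
    rw [free.apply_eq_sum f x, free.apply_eq_sum g x]
    simp only [h]

/-- The homomorphism from a free module with given values on the generators. -/
def free.desc {M : FinMod k A} (y : ∀ j, M.obj.obj (b j)) : free k b ⟶ M :=
  ObjectProperty.homMk
    { app := fun x => ModuleCat.ofHom
        { toFun := fun (g : ∀ j, b j ⟶ x) => ∑ j, M.obj.map (g j) (y j)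
          map_add' := fun g h => by
            rw [← Finset.sum_add_distrib]
            refine Finset.sum_congr rfl fun j _ => ?_
            rw [Pi.add_apply, M.property.map_add]
            rfl
          map_smul' := fun c g => by
            rw [Finset.smul_sum]
            refine Finset.sum_congr rfl fun j _ => ?_
            rw [Pi.smul_apply, M.property.map_smul]
            rfl }
      naturality := fun x x' f => by
        ext g
        change ∑ j, M.obj.map (g j ≫ f) (y j) = M.obj.map f (∑ j, M.obj.map (g j) (y j))
        rw [_root_.map_sum]
        refine Finset.sum_congr rfl fun j _ => ?_
        rw [M.obj.map_comp]
        rfl }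

theorem free.desc_apply {M : FinMod k A} (y : ∀ j, M.obj.obj (b j)) {x : A} (g : ∀ j, b j ⟶ x) :
    (free.desc y).hom.app x (show (free k b).obj.obj x from g) =
      ∑ j, M.obj.map (g j) (y j) := rfl

theorem free.desc_gen {M : FinMod k A} (y : ∀ j, M.obj.obj (b j)) (j : Fin n) :
    (free.desc y).hom.app (b j) (free.gen b j) = y j := by
  have := free.desc_apply y (Pi.single j (𝟙 (b j)) : ∀ l, b l ⟶ b j)
  refine this.trans ?_
  rw [Finset.sum_eq_single j]
  · simp
  · intro l _ hl
    rw [Pi.single_eq_of_ne hl]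
    have := FinMod.map_sum (M := M) (a := b l) (b := b j) (∅ : Finset Unit) (fun _ => 0) (y l)
    simpa using this
  · simp

instance free.projective (b : Fin n → A) : Projective (free k b) where
  factors {M N} f e _ := by
    choose y hy using fun j => FinMod.surjective_app_of_epi e (b j) (f.hom.app _ (free.gen b j))
    refine ⟨free.desc y, free.hom_ext fun j => ?_⟩
    rw [FinMod.comp_apply, free.desc_gen, hy]

/-- One representable per basis vector. Such a cover is far from minimal, but the number dim M of
summands is what makes the later dimension estimate linear. -/
theorem FinMod.exists_epi_free (M : FinMod k A) :
    ∃ (b : Fin M.dim → A) (f : free k b ⟶ M), Epi f := by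
  classical
  have := Fintype.ofFinite A
  have := M.property.finite_obj
  let e : Fin M.dim ≃ Σ a, Fin (Module.finrank k (M.obj.obj a)) :=
    (Fintype.equivFinOfCardEq (by rw [Fintype.card_sigma, M.dim_eq_sum]; simp)).symm
  refine ⟨fun j => (e j).1,
    free.desc fun j => Module.finBasis k (M.obj.obj (e j).1) (e j).2, ?_⟩
  refine FinMod.epi_of_surjective_app _ fun a x => ?_
  have hx : x ∈ LinearMap.range ((free.desc fun j =>
      Module.finBasis k (M.obj.obj (e j).1) (e j).2 :
        free k (fun j => (e j).1) ⟶ M).hom.app a).hom := by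
    rw [← (Module.finBasis k (M.obj.obj a)).sum_repr x]
    refine Submodule.sum_mem _ fun i _ => Submodule.smul_mem _ _ ?_
    obtain ⟨j, hj⟩ := e.surjective ⟨a, i⟩
    have h1 := free.desc_gen (k := k) (b := fun j => (e j).1)
      (fun j => Module.finBasis k (M.obj.obj (e j).1) (e j).2) j
    generalize hφ : (free.desc fun j =>
      Module.finBasis k (M.obj.obj (e j).1) (e j).2 : free k (fun j => (e j).1) ⟶ M) = φ at h1 ⊢
    have h2 : ∀ t : Σ a, Fin (Module.finrank k (M.obj.obj a)), t = e j →
        Module.finBasis k (M.obj.obj t.1) t.2 ∈ LinearMap.range (φ.hom.app t.1).hom := by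
      rintro t rfl
      exact ⟨_, h1⟩
    exact h2 ⟨a, i⟩ hj.symm
  exact hx

/-- A presentation of a projective module as a retract of a free module. -/
structure FreeRetract (P : FinMod k A) where
  /-- The indices of the representable summands. -/
  b : Fin P.dim → A
  /-- The inclusion. -/
  s : P ⟶ free k b
  /-- The retraction. -/
  p : free k b ⟶ P
  s_p : s ≫ p = 𝟙 P

attribute [simp] FreeRetract.s_p

@[simp]
theorem FreeRetract.s_p_assoc {P M : FinMod k A} (t : FreeRetract P) (f : P ⟶ M) :
    t.s ≫ t.p ≫ f = f := by
  rw [← Category.assoc, t.s_p, Category.id_comp]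

theorem FreeRetract.nonempty (P : FinMod k A) [Projective P] : Nonempty (FreeRetract P) := by
  obtain ⟨b, f, _⟩ := P.exists_epi_free
  exact ⟨⟨b, Projective.factorThru (𝟙 P) f, f, Projective.factorThru_comp _ _⟩⟩

end Free

/-! ### Morphisms of free modules as matrices over A. -/

section Matrices

variable {k : Type w} [Field k] {A : Type u} [Category.{v} A] [Preadditive A] [Linear k A]
  [Finite A] [∀ a b : A, Module.Finite k (a ⟶ b)]

/-- The matrix entries of a homomorphism between free modules. -/
def free.entry {n n' : ℕ} {b : Fin n → A} {b' : Fin n' → A} (f : free k b ⟶ free k b')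
    (l : Fin n') (j : Fin n) : b' l ⟶ b j :=
  (show ∀ l, b' l ⟶ b j from f.hom.app (b j) (free.gen b j)) l

variable (k) in
/-- The homomorphism between free modules with a given matrix. -/
def free.ofMatrix {n n' : ℕ} {b : Fin n → A} {b' : Fin n' → A} (m : ∀ l j, b' l ⟶ b j) :
    free k b ⟶ free k b' :=
  free.desc fun j => (show (free k b').obj.obj (b j) from fun l => m l j)

variable {n n' n'' : ℕ} {b : Fin n → A} {b' : Fin n' → A} {b'' : Fin n'' → A}

theorem free.hom_ext_entry {f g : free k b ⟶ free k b'}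
    (h : ∀ l j, free.entry f l j = free.entry g l j) : f = g :=
  free.hom_ext fun j => funext fun l => h l j

theorem free.entry_ofMatrix (m : ∀ l j, b' l ⟶ b j) (l : Fin n') (j : Fin n) :
    free.entry (free.ofMatrix k m) l j = m l j :=
  congrFun (free.desc_gen (M := free k b') (fun j l => m l j) j) l

theorem free.apply (f : free k b ⟶ free k b') {x : A} (g : ∀ j, b j ⟶ x) (l : Fin n') :
    (show ∀ l, b' l ⟶ x from f.hom.app x (show (free k b).obj.obj x from g)) l =
      ∑ j, free.entry f l j ≫ g j := by
  have h := congrFun (free.apply_eq_sum f g) l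
  refine h.trans ?_
  exact Finset.sum_apply (M := fun l => b' l ⟶ x) l Finset.univ
    fun j => fun l => free.entry f l j ≫ g j

/-- Yoneda is contravariant, so the entries of the second map come first. -/
theorem free.entry_comp (f : free k b ⟶ free k b') (g : free k b' ⟶ free k b'')
    (l : Fin n'') (j : Fin n) :
    free.entry (f ≫ g) l j = ∑ s, free.entry g l s ≫ free.entry f s j :=
  free.apply g (fun s => free.entry f s j) l

theorem free.entry_id_self (j : Fin n) : free.entry (𝟙 (free k b)) j j = 𝟙 (b j) :=
  Pi.single_eq_same (M := fun l => b l ⟶ b j) j (𝟙 (b j))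

theorem free.entry_sub (f g : free k b ⟶ free k b') (l : Fin n') (j : Fin n) :
    free.entry (f - g) l j = free.entry f l j - free.entry g l j := rfl

theorem free.entry_zero (l : Fin n') (j : Fin n) :
    free.entry (0 : free k b ⟶ free k b') l j = 0 := rfl

theorem free.entry_sum {J : Type*} (s : Finset J) (f : J → (free k b ⟶ free k b'))
    (l : Fin n') (j : Fin n) :
    free.entry (∑ i ∈ s, f i) l j = ∑ i ∈ s, free.entry (f i) l j :=
  _root_.map_sum (⟨⟨fun f => free.entry f l j, rfl⟩, fun _ _ => rfl⟩ :
    (free k b ⟶ free k b') →+ (b' l ⟶ b j)) f s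

variable (k) in
/-- The homomorphism of representable modules given by a morphism. -/
def rep {a a' : A} (c : a' ⟶ a) : free k (fun _ : Fin 1 => a) ⟶ free k (fun _ : Fin 1 => a') :=
  free.ofMatrix k fun _ _ => c

theorem rep_comp {a a' a'' : A} (c : a' ⟶ a) (d : a'' ⟶ a') :
    rep k c ≫ rep k d = rep k (d ≫ c) :=
  free.hom_ext_entry fun l j => by
    rw [free.entry_comp]
    simp only [rep, free.entry_ofMatrix]
    simp

theorem rep_id (a : A) : rep k (𝟙 a) = 𝟙 _ :=
  free.hom_ext_entry fun l j => by
    obtain rfl : l = j := Subsingleton.elim _ _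
    rw [free.entry_id_self, rep, free.entry_ofMatrix]

theorem rep_sub {a a' : A} (c d : a' ⟶ a) : rep k (c - d) = rep k c - rep k d :=
  free.hom_ext_entry fun l j => by
    rw [free.entry_sub]
    simp only [rep, free.entry_ofMatrix]

theorem rep_surjective {a a' : A}
    (f : free k (fun _ : Fin 1 => a) ⟶ free k (fun _ : Fin 1 => a')) : ∃ c, f = rep k c :=
  ⟨free.entry f 0 0, free.hom_ext_entry fun l j => by
    obtain rfl : l = 0 := Subsingleton.elim _ _
    obtain rfl : j = 0 := Subsingleton.elim _ _
    rw [rep, free.entry_ofMatrix]⟩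

theorem not_isIso_of_isRadical_rep {a a' : A} [IsLocalRing (End a')] {c : a' ⟶ a}
    (h : IsRadical (rep k c)) : ¬ IsIso c := fun _ => by
  have h1 := h (rep k (inv c))
  rw [rep_comp, IsIso.hom_inv_id, rep_id, sub_self] at h1
  have h2 : 𝟙 (free k (fun _ : Fin 1 => a')) = 0 := by
    rw [← cancel_epi (0 : free k (fun _ : Fin 1 => a') ⟶ free k (fun _ : Fin 1 => a'))]
    simp
  apply not_isZero_of_isLocalRing_end (P := a')
  rw [IsZero.iff_id_eq_zero, ← free.entry_id_self (k := k) (b := fun _ : Fin 1 => a') 0, h2,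
    free.entry_zero]

/-- By Yoneda a test map comes from some d. If c ≫ d were invertible, c would be a split
monomorphism between objects with local endomorphism rings, hence invertible. -/
theorem isRadical_rep {a a' : A} [IsLocalRing (End a')] [IsLocalRing (End a)] {c : a' ⟶ a}
    (h : ¬ IsIso c) : IsRadical (rep k c) := fun g => by
  obtain ⟨d, rfl⟩ := rep_surjective g
  have hcd : ¬ IsIso (c ≫ d) := fun _ =>
    h (isIso_of_isIso_comp not_isZero_of_isLocalRing_end c d)
  have := isIso_id_sub_of_not_isIso hcd
  rw [rep_comp, ← rep_id, ← rep_sub]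
  exact ⟨rep k (inv (𝟙 a' - c ≫ d)), by rw [rep_comp, IsIso.inv_hom_id, rep_id],
    by rw [rep_comp, IsIso.hom_inv_id, rep_id]⟩

/-- The inclusion of a representable summand. -/
def free.incl (b : Fin n → A) (j : Fin n) : free k (fun _ : Fin 1 => b j) ⟶ free k b :=
  free.ofMatrix k fun l _ => free.entry (𝟙 (free k b)) l j

/-- The projection to a representable summand. -/
def free.proj (b : Fin n → A) (j : Fin n) : free k b ⟶ free k (fun _ : Fin 1 => b j) :=
  free.ofMatrix k fun _ l => free.entry (𝟙 (free k b)) j l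

theorem free.sum_proj_incl (b : Fin n → A) :
    ∑ j, free.proj b j ≫ free.incl b j = 𝟙 (free k b) :=
  free.hom_ext_entry fun l j => by
    rw [free.entry_sum]
    simp only [free.entry_comp, free.proj, free.incl, free.entry_ofMatrix]
    simp only [Finset.univ_unique, Finset.sum_const, Finset.card_singleton, one_smul]
    rw [← free.entry_comp, Category.comp_id]

theorem free.incl_comp_proj (f : free k b ⟶ free k b') (l : Fin n') (j : Fin n) :
    free.incl b j ≫ f ≫ free.proj b' l = rep k (free.entry f l j) :=
  free.hom_ext_entry fun s t => by
    rw [← Category.assoc, rep, free.entry_ofMatrix, free.entry_comp]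
    simp only [free.entry_comp, free.proj, free.incl, free.entry_ofMatrix]
    simp only [← free.entry_comp, Category.id_comp, Category.comp_id]

/-- Radical morphisms form an ideal closed under sums, which reduces the claim to single entries
between representables. -/
theorem isRadical_free_iff (hA : ∀ a : A, IsLocalRing (End a)) (f : free k b ⟶ free k b') :
    IsRadical f ↔ ∀ l j, ¬ IsIso (free.entry f l j) := by
  constructor
  · intro h l j
    have h1 := (h.comp_right (free.proj b' l)).comp_left (free.incl b j)
    rw [free.incl_comp_proj] at h1
    exact not_isIso_of_isRadical_rep h1
  · intro h
    have e : f = ∑ l, ∑ j, free.proj b j ≫ rep k (free.entry f l j) ≫ free.incl b' l := by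
      simp only [← free.incl_comp_proj, Category.assoc]
      calc f = (∑ j, free.proj b j ≫ free.incl b j) ≫ f ≫
            (∑ l, free.proj b' l ≫ free.incl b' l) := by
            rw [free.sum_proj_incl, free.sum_proj_incl]; simp
        _ = _ := by
            simp only [Preadditive.sum_comp, Preadditive.comp_sum, Category.assoc]
    rw [e]
    exact IsRadical.sum _ _ fun l _ => IsRadical.sum _ _ fun j _ =>
      ((isRadical_rep (h l j)).comp_right _).comp_left _

end Matrices

/-! ### Cleaving functors reflect isomorphisms. -/

section Cleaving

variable {k : Type w} [Field k]
  {B : Type u} [Category.{v} B] [Preadditive B] [Linear k B]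
  {A : Type u'} [Category.{v'} A] [Preadditive A] [Linear k A] {F : B ⥤ A}

/-- By naturality the retraction carries the inverse of F f to an inverse of f. -/
theorem IsCleaving.isIso_of_isIso_map (hF : IsCleaving k F) {x y : B} (f : x ⟶ y)
    [IsIso (F.map f)] : IsIso f := by
  obtain ⟨r, hr, hr'⟩ := hF
  refine ⟨r y x (inv (F.map f)), ?_, ?_⟩
  · have h := hr' x y x x f (inv (F.map f)) (𝟙 x)
    rw [F.map_id, Category.comp_id, IsIso.hom_inv_id, ← F.map_id, hr, Category.comp_id] at h
    exact h.symm
  · have h := hr' y y x y (𝟙 y) (inv (F.map f)) f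
    rw [F.map_id, Category.id_comp, IsIso.inv_hom_id, ← F.map_id, hr, Category.id_comp] at h
    exact h.symm

end Cleaving

/-! ### Induction of free modules along F. -/

section Induction

variable {k : Type w} [Field k]
  {B : Type u} [Category.{v} B] [Preadditive B] [Linear k B]
  [Finite B] [∀ a b : B, Module.Finite k (a ⟶ b)]
  {A : Type u'} [Category.{v'} A] [Preadditive A] [Linear k A]
  [Finite A] [∀ a b : A, Module.Finite k (a ⟶ b)]
  (F : B ⥤ A)

variable {n n' n'' : ℕ} {b : Fin n → B} {b' : Fin n' → B} {b'' : Fin n'' → B}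

/-- The homomorphism of free modules induced along a functor. -/
def free.induce (f : free k b ⟶ free k b') :
    free k (fun j => F.obj (b j)) ⟶ free k (fun j => F.obj (b' j)) :=
  free.ofMatrix k fun l j => F.map (free.entry f l j)

theorem free.entry_induce (f : free k b ⟶ free k b') (l : Fin n') (j : Fin n) :
    free.entry (free.induce F f) l j = F.map (free.entry f l j) :=
  free.entry_ofMatrix _ _ _

variable {F} in
theorem IsCleaving.isRadical_induce (hF : IsCleaving k F) (hA : ∀ a : A, IsLocalRing (End a))
    (hB : ∀ a : B, IsLocalRing (End a)) {f : free k b ⟶ free k b'} (hf : IsRadical f) :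
    IsRadical (free.induce F f) := by
  rw [isRadical_free_iff hA]
  intro l j h
  rw [free.entry_induce] at h
  exact (isRadical_free_iff hB f).1 hf l j (hF.isIso_of_isIso_map _)

variable [F.Additive]

theorem free.induce_zero : free.induce F (0 : free k b ⟶ free k b') = 0 :=
  free.hom_ext_entry fun l j => by
    rw [free.entry_induce, free.entry_zero, free.entry_zero, F.map_zero]

theorem free.induce_comp (f : free k b ⟶ free k b') (g : free k b' ⟶ free k b'') :
    free.induce F (f ≫ g) = free.induce F f ≫ free.induce F g :=
  free.hom_ext_entry fun l j => by
    rw [free.entry_induce, free.entry_comp, free.entry_comp, F.map_sum]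
    simp only [free.entry_induce, F.map_comp]

theorem free.induce_comp_assoc (f : free k b ⟶ free k b') (g : free k b' ⟶ free k b'')
    {M : FinMod k A} (h : (free k fun j => F.obj (b'' j)) ⟶ M) :
    free.induce F (f ≫ g) ≫ h = free.induce F f ≫ free.induce F g ≫ h := by
  rw [free.induce_comp, Category.assoc]

end Induction

/-! ### Unit of induction and its splitting on free modules, in a common universe. -/

section Restriction

variable (k : Type w) [Field k]
  {B : Type u} [Category.{v} B] [Preadditive B] [Linear k B]
  {A : Type u'} [Category.{v'} A] [Preadditive A] [Linear k A]

/-- The inclusion of `mod B` in the functors to vector spaces of a larger universe. -/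
abbrev liftFunctor (B : Type u) [Category.{v} B] [Preadditive B] [Linear k B] :
    FinMod k B ⥤ B ⥤ ModuleCat.{max v v'} k :=
  (finDimModule k B).ι ⋙ (Functor.whiskeringRight B _ _).obj (ModuleCat.uliftFunctor.{v', v} k)

/-- The restriction of `A`-modules along a functor `B ⥤ A`. -/
abbrev restrictFunctor (F : B ⥤ A) : FinMod k A ⥤ B ⥤ ModuleCat.{max v v'} k :=
  (finDimModule k A).ι ⋙ (Functor.whiskeringLeft B A _).obj F ⋙
    (Functor.whiskeringRight B _ _).obj (ModuleCat.uliftFunctor.{v, v'} k)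

variable {k}
variable [Finite B] [∀ a b : B, Module.Finite k (a ⟶ b)]
  [Finite A] [∀ a b : A, Module.Finite k (a ⟶ b)]
  (F : B ⥤ A) {n n' : ℕ} {b : Fin n → B} {b' : Fin n' → B}

/-- The unit of induction along `F` on a free module. -/
def free.unit [F.Additive] [F.Linear k] (b : Fin n → B) :
    (liftFunctor.{w, v, u, v'} k B).obj (free k b) ⟶
      (restrictFunctor k F).obj (free k fun j => F.obj (b j)) where
  app x := ModuleCat.ofHom
    ((ULift.moduleEquiv.{w, v', v} (R := k) (M := ∀ j, F.obj (b j) ⟶ F.obj x)).symm.toLinearMap ∘ₗ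
      (LinearMap.pi fun j => (F.mapLinearMap k).comp (LinearMap.proj j)) ∘ₗ
      (ULift.moduleEquiv.{w, v, v'} (R := k) (M := ∀ j, b j ⟶ x)).toLinearMap)
  naturality x y f := by
    refine ModuleCat.hom_ext (LinearMap.ext fun g => ULift.ext _ _ (funext fun j => ?_))
    exact F.map_comp _ _

theorem free.unit_naturality [F.Additive] [F.Linear k] (f : free k b ⟶ free k b') :
    (liftFunctor.{w, v, u, v'} k B).map f ≫ free.unit F b' =
      free.unit F b ≫ (restrictFunctor k F).map (free.induce F f) := by
  ext x g
  refine ULift.ext _ _ (funext fun l => ?_)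
  have h1 := free.apply f g.down l
  have h2 := free.apply (free.induce F f) (fun j => F.map (g.down j)) l
  refine ((congrArg (fun t => F.map t) h1).trans ?_).trans h2.symm
  simp only [F.map_sum, free.entry_induce, F.map_comp]

/-- The retraction of `free.unit` given by a natural retraction of a functor. -/
def free.retraction (r : ∀ b b' : B, (F.obj b ⟶ F.obj b') →ₗ[k] (b ⟶ b'))
    (hr : ∀ (b b' b₁' : B) (g : F.obj b ⟶ F.obj b') (h : b' ⟶ b₁'),
      r b b₁' (g ≫ F.map h) = r b b' g ≫ h) (b : Fin n → B) :
    (restrictFunctor k F).obj (free k fun j => F.obj (b j)) ⟶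
      (liftFunctor.{w, v, u, v'} k B).obj (free k b) where
  app x := ModuleCat.ofHom
    ((ULift.moduleEquiv.{w, v, v'} (R := k) (M := ∀ j, b j ⟶ x)).symm.toLinearMap ∘ₗ
      (LinearMap.pi fun j => (r (b j) x).comp (LinearMap.proj j)) ∘ₗ
      (ULift.moduleEquiv.{w, v', v} (R := k) (M := ∀ j, F.obj (b j) ⟶ F.obj x)).toLinearMap)
  naturality x y f := by
    refine ModuleCat.hom_ext (LinearMap.ext fun g => ULift.ext _ _ (funext fun j => ?_))
    exact hr _ _ _ _ _

variable {F}
variable {r : ∀ b b' : B, (F.obj b ⟶ F.obj b') →ₗ[k] (b ⟶ b')}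
    (hr : ∀ (b b' b₁' : B) (g : F.obj b ⟶ F.obj b') (h : b' ⟶ b₁'),
      r b b₁' (g ≫ F.map h) = r b b' g ≫ h)

theorem free.unit_retraction [F.Additive] [F.Linear k]
    (hr' : ∀ (b b' : B) (f : b ⟶ b'), r b b' (F.map f) = f) (b : Fin n → B) :
    free.unit F b ≫ free.retraction F r hr b = 𝟙 _ := by
  ext x g
  exact ULift.ext _ _ (funext fun l => hr' _ _ _)

/-- This uses naturality of r in its first variable; naturality in the second already made the
retraction a morphism of functors. -/
theorem free.retraction_naturality
    (hr' : ∀ (b₁ b b' : B) (f : b₁ ⟶ b) (g : F.obj b ⟶ F.obj b'),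
      r b₁ b' (F.map f ≫ g) = f ≫ r b b' g) (f : free k b ⟶ free k b') :
    (restrictFunctor k F).map (free.induce F f) ≫ free.retraction F r hr b' =
      free.retraction F r hr b ≫ (liftFunctor.{w, v, u, v'} k B).map f := by
  ext x g
  refine ULift.ext _ _ (funext fun l => ?_)
  have h1 := free.apply f (fun j => r _ _ (g.down j)) l
  have h2 := free.apply (free.induce F f) g.down l
  refine ((congrArg (fun t => r _ _ t) h2).trans ?_).trans h1.symm
  simp only [_root_.map_sum, free.entry_induce, hr']

end Restriction

/-! ### Induction of projective modules and of complexes. -/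

section Induced

variable {k : Type w} [Field k]
  {B : Type u} [Category.{v} B] [Preadditive B] [Linear k B]
  {A : Type u'} [Category.{v'} A] [Preadditive A] [Linear k A]
  [Finite B] [∀ a b : B, Module.Finite k (a ⟶ b)]
  [Finite A] [∀ a b : A, Module.Finite k (a ⟶ b)]
  (F : B ⥤ A)

/-- A module induced along `F` from a projective module `P`. -/
structure Induced (P : FinMod k B) extends FreeRetract P where
  /-- The induced module. -/
  obj : FinMod k A
  /-- The inclusion in a free module. -/
  i : obj ⟶ free k fun j => F.obj (b j)
  /-- The retraction from a free module. -/
  q : (free k fun j => F.obj (b j)) ⟶ obj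
  i_q : i ≫ q = 𝟙 obj
  q_i : q ≫ i = free.induce F (p ≫ s)

namespace Induced

attribute [simp] i_q q_i

variable {F}

/-- A projective P is the image of the idempotent p ≫ s on a free module; the induced idempotent is
split over A. -/
theorem nonempty [F.Additive] (P : FinMod k B) [Projective P] : Nonempty (Induced F P) := by
  obtain ⟨t⟩ := FreeRetract.nonempty P
  obtain ⟨Q, i, q, h, h'⟩ := IsIdempotentComplete.idempotents_split _
    (free.induce F (t.p ≫ t.s)) (by rw [← free.induce_comp]; simp)
  exact ⟨⟨t, Q, i, q, h, h'⟩⟩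

theorem projective {P : FinMod k B} (I : Induced F P) : Projective I.obj :=
  Retract.projective (⟨I.i, I.q, I.i_q⟩ : Retract I.obj (free k fun j => F.obj (I.b j)))

variable {P P' P'' : FinMod k B} (I : Induced F P) (I' : Induced F P') (I'' : Induced F P'')

@[simp]
theorem q_i_assoc {M : FinMod k A} (f : (free k fun j => F.obj (I.b j)) ⟶ M) :
    I.q ≫ I.i ≫ f = free.induce F (I.p ≫ I.s) ≫ f := by
  rw [← Category.assoc, I.q_i]

/-- The homomorphism of induced modules given by a homomorphism. -/
noncomputable def map (f : P ⟶ P') : I.obj ⟶ I'.obj := I.i ≫ free.induce F (I.p ≫ f ≫ I'.s) ≫ I'.q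

theorem map_zero [F.Additive] : I.map I' 0 = 0 := by
  simp [map, free.induce_zero]

theorem map_id [F.Additive] : I.map I (𝟙 P) = 𝟙 I.obj := by
  rw [map, Category.id_comp, ← I.q_i, Category.assoc, I.i_q, Category.comp_id, I.i_q]

theorem map_comp [F.Additive] (f : P ⟶ P') (g : P' ⟶ P'') :
    I.map I' f ≫ I'.map I'' g = I.map I'' (f ≫ g) := by
  simp only [map, Category.assoc, q_i_assoc, ← free.induce_comp_assoc, FreeRetract.s_p_assoc]

theorem isZero [F.Additive] (hP : IsZero P) : IsZero I.obj := by
  rw [IsZero.iff_id_eq_zero, ← I.map_id, hP.eq_of_src (𝟙 P) 0, I.map_zero]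

theorem isRadical_map (hF : IsCleaving k F) (hA : ∀ a : A, IsLocalRing (End a))
    (hB : ∀ a : B, IsLocalRing (End a)) {f : P ⟶ P'} (hf : IsRadical f) :
    IsRadical (I.map I' f) :=
  ((hF.isRadical_induce hA hB ((hf.comp_right _).comp_left _)).comp_right _).comp_left _

/-- The unit of induction. -/
noncomputable def unit [F.Additive] [F.Linear k] :
    (liftFunctor.{w, v, u, v'} k B).obj P ⟶ (restrictFunctor k F).obj I.obj :=
  (liftFunctor k B).map I.s ≫ free.unit F I.b ≫ (restrictFunctor k F).map I.q

theorem unit_naturality [F.Additive] [F.Linear k] (f : P ⟶ P') :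
    (liftFunctor.{w, v, u, v'} k B).map f ≫ I'.unit =
      I.unit ≫ (restrictFunctor k F).map (I.map I' f) := by
  have h1 : (restrictFunctor k F).map I.q ≫ (restrictFunctor k F).map (I.map I' f) =
      (restrictFunctor k F).map (free.induce F (I.p ≫ f ≫ I'.s)) ≫
        (restrictFunctor k F).map I'.q := by
    rw [← Functor.map_comp, ← Functor.map_comp]
    congr 1
    simp only [map, q_i_assoc, ← free.induce_comp_assoc, Category.assoc, FreeRetract.s_p_assoc]
  simp only [unit, Category.assoc]
  rw [h1, ← Category.assoc (free.unit F I.b), ← free.unit_naturality]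
  simp only [← Category.assoc, ← Functor.map_comp, FreeRetract.s_p, Category.id_comp]

variable {r : ∀ b b' : B, (F.obj b ⟶ F.obj b') →ₗ[k] (b ⟶ b')}
    (hr : ∀ (b b' b₁' : B) (g : F.obj b ⟶ F.obj b') (h : b' ⟶ b₁'),
      r b b₁' (g ≫ F.map h) = r b b' g ≫ h)

/-- The retraction of the unit given by a natural retraction of `F`. -/
noncomputable def retraction :
    (restrictFunctor k F).obj I.obj ⟶ (liftFunctor.{w, v, u, v'} k B).obj P :=
  (restrictFunctor k F).map I.i ≫ free.retraction F r hr I.b ≫ (liftFunctor k B).map I.p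

theorem retraction_naturality [F.Additive]
    (hr' : ∀ (b₁ b b' : B) (f : b₁ ⟶ b) (g : F.obj b ⟶ F.obj b'),
      r b₁ b' (F.map f ≫ g) = f ≫ r b b' g) (f : P ⟶ P') :
    (restrictFunctor k F).map (I.map I' f) ≫ I'.retraction hr =
      I.retraction hr ≫ (liftFunctor.{w, v, u, v'} k B).map f := by
  have h1 : (restrictFunctor k F).map (I.map I' f) ≫ (restrictFunctor k F).map I'.i =
      (restrictFunctor k F).map I.i ≫
        (restrictFunctor k F).map (free.induce F (I.p ≫ f ≫ I'.s)) := by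
    rw [← Functor.map_comp, ← Functor.map_comp]
    congr 1
    simp only [map, q_i, ← free.induce_comp, Category.assoc, FreeRetract.s_p_assoc]
  simp only [retraction, Category.assoc]
  rw [← Category.assoc ((restrictFunctor k F).map (I.map I' f)), h1, Category.assoc,
    ← Category.assoc ((restrictFunctor k F).map (free.induce F _)),
    free.retraction_naturality hr hr', Category.assoc, ← Functor.map_comp, ← Functor.map_comp]
  simp

theorem unit_retraction [F.Additive] [F.Linear k]
    (hr' : ∀ (b₁ b b' : B) (f : b₁ ⟶ b) (g : F.obj b ⟶ F.obj b'),
      r b₁ b' (F.map f ≫ g) = f ≫ r b b' g)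
    (hr'' : ∀ (b b' : B) (f : b ⟶ b'), r b b' (F.map f) = f) :
    I.unit ≫ I.retraction hr = 𝟙 _ := by
  simp only [unit, retraction, Category.assoc]
  rw [← Functor.map_comp_assoc, q_i,
    ← Category.assoc ((restrictFunctor k F).map (free.induce F _)),
    free.retraction_naturality hr hr', Category.assoc,
    ← Category.assoc (free.unit F I.b), free.unit_retraction hr hr'', Category.id_comp,
    ← Functor.map_comp, ← Functor.map_comp]
  simp

/-- The induced module embeds in a sum of dim P representables, each of dimension at most N. -/
theorem dim_le {N : ℕ} (hN : ∀ a : A, ∑ᶠ x : A, Module.finrank k (a ⟶ x) ≤ N) :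
    I.obj.dim ≤ N * P.dim := by
  have := Fintype.ofFinite A
  have h1 : ∀ a, Module.finrank k (I.obj.obj.obj a) ≤
      ∑ j, Module.finrank k (F.obj (I.b j) ⟶ a) := by
    intro a
    rw [← Module.finrank_pi_fintype]
    refine LinearMap.finrank_le_finrank_of_injective (f := ((I.i).hom.app a).hom)
      (M' := ∀ j, F.obj (I.b j) ⟶ a) ?_
    refine Function.LeftInverse.injective (g := I.q.hom.app a) fun x => ?_
    have := congrArg (fun f => f.hom.app a x) I.i_q
    exact this
  rw [FinMod.dim_eq_sum]
  calc _ ≤ ∑ a, ∑ j, Module.finrank k (F.obj (I.b j) ⟶ a) := Finset.sum_le_sum fun a _ => h1 a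
    _ = ∑ j, ∑ a, Module.finrank k (F.obj (I.b j) ⟶ a) := Finset.sum_comm
    _ ≤ ∑ j : Fin P.dim, N := Finset.sum_le_sum fun j _ => by
        rw [← finsum_eq_sum_of_fintype]; exact hN _
    _ = N * P.dim := by simp [mul_comm]

end Induced

/-- The functor to complexes of functors given by `liftFunctor`. -/
noncomputable abbrev liftComplex (k : Type w) [Field k] (B : Type u) [Category.{v} B]
    [Preadditive B] [Linear k B] (m : ℕ) :
    Cm k B m ⥤ CochainComplex (B ⥤ ModuleCat.{max v v'} k) ℤ :=
  ObjectProperty.ι _ ⋙ (liftFunctor.{w, v, u, v'} k B).mapHomologicalComplex _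

variable (k) in
/-- The functor to complexes of functors given by `restrictFunctor`. -/
noncomputable abbrev restrictComplex (F : B ⥤ A) (m : ℕ) :
    Cm k A m ⥤ CochainComplex (B ⥤ ModuleCat.{max v v'} k) ℤ :=
  ObjectProperty.ι _ ⋙ (restrictFunctor k F).mapHomologicalComplex _

/-- Every object of `C_m(proj B)` is a retract of the restriction of an object of `C_m(proj A)`
whose dimension is bounded linearly. -/
theorem exists_retract_restrictComplex {F : B ⥤ A} [F.Additive] [F.Linear k]
    (hF : IsCleaving k F) (hA : ∀ a : A, IsLocalRing (End a)) (hB : ∀ a : B, IsLocalRing (End a))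
    {N : ℕ} (hN : ∀ a : A, ∑ᶠ x : A, Module.finrank k (a ⟶ x) ≤ N) {m : ℕ} (P : Cm k B m) :
    ∃ Q : Cm k A m, Q.dim ≤ N * P.dim ∧
      Nonempty (Retract ((liftComplex.{w, v, u, v'} k B m).obj P)
        ((restrictComplex k F m).obj Q)) := by
  have hproj := P.property.projective
  let I : ∀ i, Induced F (P.obj.X i) := fun i => (Induced.nonempty (P.obj.X i)).some
  -- Induce termwise; the choices made in different degrees are harmless because `Induced.map` is
  -- functorial for any choices.
  let Q : CochainComplex (FinMod k A) ℤ :=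
    { X := fun i => (I i).obj
      d := fun i j => (I i).map (I j) (P.obj.d i j)
      shape := fun i j h => by rw [P.obj.shape i j h, Induced.map_zero]
      d_comp_d' := fun i j l _ _ => by
        rw [Induced.map_comp, HomologicalComplex.d_comp_d, Induced.map_zero] }
  have hQ : IsInCm k A m Q :=
    { projective := fun i => (I i).projective
      minimal := (isMinimal_iff Q fun i => (I i).projective).2 fun i =>
        (I i).isRadical_map (I (i + 1)) hF hA hB
          ((isMinimal_iff _ hproj).1 P.property.minimal i)
      isZero := fun i hi => (I i).isZero (P.property.isZero i hi) }
  refine ⟨⟨Q, hQ⟩, ?_, ?_⟩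
  · rw [Cm.dim, Cm.dim, Finset.mul_sum]
    exact Finset.sum_le_sum fun i _ => (I i).dim_le hN
  · obtain ⟨r, hr, hr'⟩ := hF
    have h1 : ∀ (b b' b₁' : B) (g : F.obj b ⟶ F.obj b') (h : b' ⟶ b₁'),
        r b b₁' (g ≫ F.map h) = r b b' g ≫ h := fun b b' b₁' g h => by
      simpa using hr' b b b' b₁' (𝟙 b) g h
    have h2 : ∀ (b₁ b b' : B) (f : b₁ ⟶ b) (g : F.obj b ⟶ F.obj b'),
        r b₁ b' (F.map f ≫ g) = f ≫ r b b' g := fun b₁ b b' f g => by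
      simpa using hr' b₁ b b' b' f g (𝟙 b')
    exact ⟨⟨{ f := fun i => (I i).unit
              comm' := fun i j _ => ((I i).unit_naturality (I j) _).symm },
            { f := fun i => (I i).retraction h1
              comm' := fun i j _ => ((I i).retraction_naturality (I j) h1 h2 _).symm },
            HomologicalComplex.hom_ext _ _ fun i => (I i).unit_retraction h1 h2 hr⟩⟩

end Induced

/-! ### Dimensions and direct sums. -/

section Dimension

variable {k : Type w} [Field k] {A : Type u} [Category.{v} A] [Preadditive A] [Linear k A]

theorem IsBoundedCategory.finite_hom (hA : IsBoundedCategory k A) (a b : A) :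
    Module.Finite k (a ⟶ b) := by
  classical
  have := hA.finite_out a
  refine Module.Finite.of_surjective (DirectSum.component k A (fun x => (a ⟶ x)) b) fun f => ?_
  exact ⟨DirectSum.lof k A (fun x => (a ⟶ x)) b f, DirectSum.component.lof_self _ _ _⟩

variable [Finite A]

theorem FinMod.dim_add_le {Y Z X : FinMod k A} (i : Y ⟶ X) (j : Z ⟶ X) (p : X ⟶ Y) (q : X ⟶ Z)
    (hip : i ≫ p = 𝟙 Y) (hjq : j ≫ q = 𝟙 Z) (hiq : i ≫ q = 0) (hjp : j ≫ p = 0) :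
    Y.dim + Z.dim ≤ X.dim := by
  have := Fintype.ofFinite A
  have := X.property.finite_obj
  have := Y.property.finite_obj
  have := Z.property.finite_obj
  rw [FinMod.dim_eq_sum, FinMod.dim_eq_sum, FinMod.dim_eq_sum, ← Finset.sum_add_distrib]
  refine Finset.sum_le_sum fun a _ => ?_
  rw [← Module.finrank_prod]
  refine LinearMap.finrank_le_finrank_of_injective
    (f := LinearMap.coprod (i.hom.app a).hom (j.hom.app a).hom) ?_
  refine Function.LeftInverse.injective
    (g := LinearMap.prod (p.hom.app a).hom (q.hom.app a).hom) fun x => ?_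
  have h1 : p.hom.app a (i.hom.app a x.1) = x.1 := congrArg (fun f => f.hom.app a x.1) hip
  have h2 : q.hom.app a (j.hom.app a x.2) = x.2 := congrArg (fun f => f.hom.app a x.2) hjq
  have h3 : q.hom.app a (i.hom.app a x.1) = 0 := congrArg (fun f => f.hom.app a x.1) hiq
  have h4 : p.hom.app a (j.hom.app a x.2) = 0 := congrArg (fun f => f.hom.app a x.2) hjp
  change (p.hom.app a (i.hom.app a x.1 + j.hom.app a x.2),
    q.hom.app a (i.hom.app a x.1 + j.hom.app a x.2)) = x
  rw [_root_.map_add, _root_.map_add, h1, h2, h3, h4, add_zero, zero_add]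

theorem FinMod.isZero_of_dim_eq_zero {X : FinMod k A} (h : X.dim = 0) : IsZero X := by
  have := Fintype.ofFinite A
  rw [FinMod.dim_eq_sum, Finset.sum_eq_zero_iff] at h
  rw [IsZero.iff_id_eq_zero]
  refine FinMod.hom_ext_apply fun a x => ?_
  have := X.property.finite_obj a
  have := Module.finrank_zero_iff.1 (h a (Finset.mem_univ a))
  exact Subsingleton.elim _ _

variable {m : ℕ}

theorem Cm.isZero_of_dim_eq_zero {P : Cm k A m} (h : P.dim = 0) : IsZero P := by
  rw [Cm.dim, Finset.sum_eq_zero_iff] at h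
  rw [IsZero.iff_id_eq_zero]
  refine ObjectProperty.hom_ext _ (HomologicalComplex.hom_ext _ _ fun i => IsZero.eq_of_src ?_ _ _)
  by_cases hi : i < 0 ∨ (m : ℤ) < i
  · exact P.property.isZero i hi
  · push Not at hi
    lift i to ℕ using hi.1
    exact FinMod.isZero_of_dim_eq_zero (h i (by rw [Finset.mem_range]; omega))

theorem Cm.dim_add_le {P Y Z : Cm k A m} (b : BinaryBicone Y Z) (e : P ≅ b.pt) :
    Y.dim + Z.dim ≤ P.dim := by
  rw [Cm.dim, Cm.dim, Cm.dim, ← Finset.sum_add_distrib]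
  have hf : ∀ {X X' : Cm k A m} {f g : X ⟶ X'} (i : ℤ), f = g → f.hom.f i = g.hom.f i :=
    fun i h => by rw [h]
  refine Finset.sum_le_sum fun i _ => FinMod.dim_add_le ((b.inl ≫ e.inv).hom.f i)
    ((b.inr ≫ e.inv).hom.f i) ((e.hom ≫ b.fst).hom.f i) ((e.hom ≫ b.snd).hom.f i) ?_ ?_ ?_ ?_
  · exact hf i (show (b.inl ≫ e.inv) ≫ (e.hom ≫ b.fst) = 𝟙 Y by simp)
  · exact hf i (show (b.inr ≫ e.inv) ≫ (e.hom ≫ b.snd) = 𝟙 Z by simp)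
  · exact hf i (show (b.inl ≫ e.inv) ≫ (e.hom ≫ b.snd) = 0 by simp)
  · exact hf i (show (b.inr ≫ e.inv) ≫ (e.hom ≫ b.fst) = 0 by simp)

end Dimension

/-! ### Restriction: dimension bound and finiteness. -/

section Comparison

variable {k : Type w} [Field k]
  {B : Type u} [Category.{v} B] [Preadditive B] [Linear k B]
  {A : Type u'} [Category.{v'} A] [Preadditive A] [Linear k A]
  [Finite B] [Finite A] {F : B ⥤ A} {m : ℕ}

/-- P^i(b) embeds in Q^i(F b). The factor |B| allows for `F` identifying objects. -/
theorem dim_le_of_retract_restrictComplex {P : Cm k B m} {Q : Cm k A m}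
    (h : Retract ((liftComplex.{w, v, u, v'} k B m).obj P) ((restrictComplex k F m).obj Q)) :
    P.dim ≤ Nat.card B * Q.dim := by
  have := Fintype.ofFinite B
  have := Fintype.ofFinite A
  rw [Cm.dim, Cm.dim, Finset.mul_sum]
  refine Finset.sum_le_sum fun i _ => ?_
  have := (Q.obj.X i).property.finite_obj
  rw [FinMod.dim_eq_sum]
  calc _ ≤ ∑ _b : B, (Q.obj.X i).dim := Finset.sum_le_sum fun b _ => ?_
    _ = Nat.card B * (Q.obj.X i).dim := by simp
  have h1 : Module.finrank k ((P.obj.X i).obj.obj b) ≤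
      Module.finrank k ((Q.obj.X i).obj.obj (F.obj b)) := by
    rw [← (ULift.moduleEquiv.{w, v, v'} (R := k) (M := (P.obj.X i).obj.obj b)).finrank_eq,
      ← (ULift.moduleEquiv.{w, v', v} (R := k) (M := (Q.obj.X i).obj.obj (F.obj b))).finrank_eq]
    refine LinearMap.finrank_le_finrank_of_injective (f := ((h.i.f i).app b).hom) ?_
    refine Function.LeftInverse.injective (g := (h.r.f i).app b) fun x => ?_
    exact congrArg (fun f => (f.f i).app b x) h.retract
  refine h1.trans ?_
  rw [FinMod.dim_eq_sum]
  exact Finset.single_le_sum (f := fun a => Module.finrank k ((Q.obj.X i).obj.obj a))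
    (fun _ _ => Nat.zero_le _) (Finset.mem_univ _)

instance finite_hom_restrictComplex (Q : Cm k A m) :
    Module.Finite k ((restrictComplex k F m).obj Q ⟶ (restrictComplex k F m).obj Q) := by
  have : ∀ i, Module.Finite k (((restrictComplex k F m).obj Q).X i ⟶
      ((restrictComplex k F m).obj Q).X i) := fun i => by
    have : ∀ b, Module.Finite k ((((restrictComplex k F m).obj Q).X i).obj b) := fun b => by
      have := (Q.obj.X i).property.finite_obj (F.obj b)
      exact Module.Finite.equiv
        (ULift.moduleEquiv.{w, v', v} (R := k) (M := (Q.obj.X i).obj.obj (F.obj b))).symm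
    exact finite_hom_functor _ _
  refine finite_hom_complex _ _ (Finset.Icc 0 (m : ℤ)) fun i hi => ?_
  exact (restrictFunctor k F).map_isZero
    (Q.property.isZero i (by rw [Finset.mem_Icc] at hi; omega))

theorem isLocalRing_end_map {C : Type*} [Category* C] [Preadditive C] {D : Type*} [Category* D]
    [Preadditive D] (G : C ⥤ D) [G.Additive] [G.Full] [G.Faithful] (X : C)
    [h : IsLocalRing (End X)] : IsLocalRing (End (G.obj X)) := by
  have : Nontrivial (End (G.obj X)) := by
    refine ⟨⟨1, 0, fun h' => one_ne_zero (α := End X) (G.map_injective ?_)⟩⟩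
    exact (G.map_id X).trans (h'.trans (G.map_zero X X).symm)
  refine IsLocalRing.of_isUnit_or_isUnit_one_sub_self fun f => ?_
  obtain ⟨g, rfl⟩ := G.map_surjective f
  rcases isIso_or_isIso_of_add_eq_id (add_sub_cancel g (𝟙 X)) with hg | hg
  · exact Or.inl ((isUnit_iff_isIso _).2 inferInstance)
  · refine Or.inr ((isUnit_iff_isIso _).2 ?_)
    have : IsIso (G.map (𝟙 X - g)) := inferInstance
    rwa [G.map_sub, G.map_id] at this

end Comparison

/-! ### Passing to an indecomposable summand. -/

section Indecomposable

variable {k : Type w} [Field k] {B : Type u} [Category.{v} B]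
  {A : Type u'} [Category.{v'} A] [Preadditive A] [Linear k A] [Finite A] {F : B ⥤ A} {m : ℕ}

/-- An object with local endomorphism ring that is a retract of the restriction of an object is a
retract of the restriction of an indecomposable object of at most the same dimension. -/
theorem exists_indecomposable_retract {X : CochainComplex (B ⥤ ModuleCat.{max v v'} k) ℤ}
    [IsLocalRing (End X)] (Q : Cm k A m)
    (hQ : Nonempty (Retract X ((restrictComplex k F m).obj Q))) :
    ∃ Q' : Cm k A m, Q'.dim ≤ Q.dim ∧ IsIndecomposable Q' ∧
      Nonempty (Retract X ((restrictComplex k F m).obj Q')) := by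
  induction hn : Q.dim using Nat.strong_induction_on generalizing Q with
  | _ n ih =>
    subst hn
    by_cases hind : IsIndecomposable Q
    · exact ⟨Q, le_rfl, hind, hQ⟩
    obtain ⟨h⟩ := hQ
    have hQ0 : ¬ IsZero Q := fun h0 => by
      have h1 := (restrictComplex k F m).map_isZero h0
      apply not_isZero_of_isLocalRing_end (P := X)
      rw [IsZero.iff_id_eq_zero, ← h.retract, h1.eq_of_tgt h.i 0, zero_comp]
    have hex : ∃ (Y Z : Cm k A m) (b : BinaryBicone Y Z), Nonempty b.IsBilimit ∧
        Nonempty (Q ≅ b.pt) ∧ ¬ IsZero Y ∧ ¬ IsZero Z := by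
      by_contra hcon
      push Not at hcon
      exact hind ⟨hQ0, fun Y Z b hb e => or_iff_not_imp_left.2 fun hY => hcon Y Z b hb e hY⟩
    obtain ⟨Y, Z, b, ⟨hb⟩, ⟨e⟩, hY, hZ⟩ := hex
    have hdim := Cm.dim_add_le b e
    have hY0 : Y.dim ≠ 0 := fun h0 => hY (Cm.isZero_of_dim_eq_zero h0)
    have hZ0 : Z.dim ≠ 0 := fun h0 => hZ (Cm.isZero_of_dim_eq_zero h0)
    let V := restrictComplex.{w, v, u} k F m
    have htot : b.fst ≫ b.inl + b.snd ≫ b.inr = 𝟙 b.pt := IsBilimit.binary_total hb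
    -- The identity of X is a sum of endomorphisms through the restrictions of Y and Z, so locality
    -- makes one of them invertible. Both Y and Z are smaller than Q, since the other is nonzero.
    have hsum : (h.i ≫ V.map e.hom ≫ V.map b.fst) ≫ (V.map b.inl ≫ V.map e.inv ≫ h.r) +
        (h.i ≫ V.map e.hom ≫ V.map b.snd) ≫ (V.map b.inr ≫ V.map e.inv ≫ h.r) = 𝟙 X := by
      have h2 : V.map e.hom ≫ V.map (b.fst ≫ b.inl + b.snd ≫ b.inr) ≫ V.map e.inv = 𝟙 _ := by
        rw [htot, V.map_id, Category.id_comp, ← V.map_comp, e.hom_inv_id, V.map_id]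
      rw [V.map_add, V.map_comp, V.map_comp] at h2
      calc _ = h.i ≫ (V.map e.hom ≫ (V.map b.fst ≫ V.map b.inl + V.map b.snd ≫ V.map b.inr) ≫
            V.map e.inv) ≫ h.r := by
            simp only [Preadditive.comp_add, Preadditive.add_comp, Category.assoc]
        _ = 𝟙 X := by rw [h2, Category.id_comp, h.retract]
    have key : ∀ (W : Cm k A m) (s : X ⟶ V.obj W) (t : V.obj W ⟶ X), W.dim < Q.dim →
        IsIso (s ≫ t) → ∃ Q' : Cm k A m, Q'.dim ≤ Q.dim ∧ IsIndecomposable Q' ∧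
          Nonempty (Retract X (V.obj Q')) := fun W s t hW hst => by
      obtain ⟨Q', h1, h2, h3⟩ := ih W.dim hW W ⟨⟨s, t ≫ inv (s ≫ t), by
        rw [← Category.assoc, IsIso.hom_inv_id]⟩⟩ rfl
      exact ⟨Q', h1.trans hW.le, h2, h3⟩
    rcases isIso_or_isIso_of_add_eq_id hsum with hi | hi
    · exact key Y _ _ (by omega) hi
    · exact key Z _ _ (by omega) hi

end Indecomposable

/-! ### Extracting the dimension sequence. -/

section Sequences

variable {k : Type w} [Field k] {A : Type u} [Category.{v} A] [Preadditive A] [Linear k A]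

/-- A criterion for strongly unbounded type in which dimensions are only estimated. -/
theorem isStronglyUnbounded_of_bounds {m : ℕ} (d : ℕ → ℕ) (hd : StrictMono d) (M N : ℕ)
    (Q : ℕ → ℕ → Cm k A m) (hind : ∀ i j, IsIndecomposable (Q i j))
    (hle : ∀ i j, (Q i j).dim ≤ N * d i) (hge : ∀ i j, d i ≤ M * (Q i j).dim)
    (hfin : ∀ i (X : Cm k A m), {j | Nonempty (Q i j ≅ X)}.Finite) :
    IsStronglyUnbounded k A m := by
  -- Pigeonhole: infinitely many j share the N · d i + 1 possible dimensions.
  have h1 : ∀ i, ∃ e, {j | (Q i j).dim = e}.Infinite := fun i => by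
    obtain ⟨e, he⟩ := Finite.exists_infinite_fiber
      (fun j => (⟨(Q i j).dim, Nat.lt_succ_of_le (hle i j)⟩ : Fin (N * d i + 1)))
    rw [Set.infinite_coe_iff] at he
    refine ⟨e, he.mono fun j hj => ?_⟩
    exact congrArg Fin.val hj
  choose e he using h1
  have h2 : ∀ i, ∃ P : ℕ → Cm k A m, (∀ j, IsIndecomposable (P j) ∧ (P j).dim = e i) ∧
      Pairwise fun j l => IsEmpty (P j ≅ P l) := fun i => by
    let q : ℕ → Quotient (isIsomorphicSetoid (Cm k A m)) := fun j => Quotient.mk _ (Q i j)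
    -- Each isomorphism class is hit only finitely often, so infinitely many classes occur.
    have hinf : (q '' {j | (Q i j).dim = e i}).Infinite := fun hf => by
      refine he i ((hf.preimage' (f := q) fun c _ => ?_).subset (Set.subset_preimage_image _ _))
      induction c using Quotient.inductionOn with
      | h X =>
        refine (hfin i X).subset fun j hj => ?_
        exact Quotient.exact (s := isIsomorphicSetoid (Cm k A m)) hj
    let g := hinf.natEmbedding
    choose t ht ht' using fun j => (g j).2
    refine ⟨fun j => Q i (t j), fun j => ⟨hind _ _, ht j⟩, fun j l hjl => ⟨fun iso => hjl ?_⟩⟩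
    refine g.injective (Subtype.ext ?_)
    rw [← ht' j, ← ht' l]
    exact Quotient.sound (s := isIsomorphicSetoid (Cm k A m)) ⟨iso⟩
  -- Follows from i ≤ d i ≤ M · e i. As e need not be monotone, a strictly increasing subsequence is
  -- taken afterwards.
  have h3 : Filter.Tendsto e Filter.atTop Filter.atTop := by
    refine Filter.tendsto_atTop.2 fun c => ?_
    filter_upwards [Filter.eventually_gt_atTop (M * c)] with i hi
    obtain ⟨j, hj⟩ := (he i).nonempty
    have h4 := hge i j
    rw [Set.mem_ofPred_eq] at hj
    rw [hj] at h4
    by_contra hc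
    have h5 : M * e i ≤ M * c := Nat.mul_le_mul_left _ (by omega)
    have h6 : i ≤ d i := hd.le_apply
    omega
  obtain ⟨φ, _, hφ⟩ := Filter.strictMono_subseq_of_tendsto_atTop h3
  exact ⟨e ∘ φ, hφ, fun i => h2 (φ i)⟩

end Sequences

/-- Cleaving functors preserve strongly unbounded type of categories of minimal complexes of
projective modules. -/
theorem IsStronglyUnbounded.of_isCleaving {k : Type w} [Field k]
    {B : Type u} [Category.{v} B] [Preadditive B] [Linear k B]
    {A : Type u'} [Category.{v'} A] [Preadditive A] [Linear k A]
    (hB : IsBoundedCategory k B) (hA : IsBoundedCategory k A)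
    {m : ℕ} (hm : IsStronglyUnbounded k B m)
    {F : B ⥤ A} [F.Additive] [F.Linear k] (hF : IsCleaving k F) :
    IsStronglyUnbounded k A m := by
  have := hB.finite_obj
  have := hA.finite_obj
  have := hB.finite_hom
  have := hA.finite_hom
  obtain ⟨N, hN⟩ : ∃ N, ∀ a : A, ∑ᶠ x : A, Module.finrank k (a ⟶ x) ≤ N := by
    obtain ⟨N, hN⟩ := (Set.finite_range fun a : A => ∑ᶠ x : A, Module.finrank k (a ⟶ x)).bddAbove
    exact ⟨N, fun a => hN ⟨a, rfl⟩⟩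
  obtain ⟨d, hd, hd'⟩ := hm
  choose P hP hPiso using hd'
  let U := liftComplex.{w, v, u, v'} k B m
  have hloc : ∀ i j, IsLocalRing (End (U.obj (P i j))) := fun i j =>
    have := (hP i j).1.isLocalRing_end k
    isLocalRing_end_map U (P i j)
  have hex : ∀ i j, ∃ Q : Cm k A m, Q.dim ≤ N * d i ∧ IsIndecomposable Q ∧
      Nonempty (Retract (U.obj (P i j)) ((restrictComplex k F m).obj Q)) := fun i j => by
    obtain ⟨Q, hQ, hr⟩ := exists_retract_restrictComplex hF hA.isLocalRing_end hB.isLocalRing_end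
      hN (P i j)
    have := hloc i j
    obtain ⟨Q', hQ', h1, h2⟩ := exists_indecomposable_retract Q hr
    rw [(hP i j).2] at hQ
    exact ⟨Q', hQ'.trans hQ, h1, h2⟩
  choose Q hQ hind hret using hex
  refine isStronglyUnbounded_of_bounds d hd (Nat.card B) N Q hind hQ (fun i j => ?_) fun i X => ?_
  · rw [← (hP i j).2]
    exact dim_le_of_retract_restrictComplex (hret i j).some
  -- All P i j whose Q i j is isomorphic to X are pairwise non-isomorphic summands of the single
  -- restriction of X.
  · refine Set.finite_coe_iff.1 (finite_of_retracts k (X := (restrictComplex.{w, v, u} k F m).obj X)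
      (fun j : {j | Nonempty (Q i j ≅ X)} => U.obj (P i j)) (fun j => hloc i j) (fun j => ?_)
      fun j l hjl => ⟨fun e => ?_⟩)
    · exact ⟨(hret i j).some.trans
        (Retract.ofIso ((restrictComplex.{w, v, u} k F m).mapIso j.2.some))⟩
    · exact (hPiso i fun h => hjl (Subtype.ext h)).false (U.preimageIso e)

end CleavingFunctors

theorem mainTheorem3 {k : Type w} [Field k] [IsAlgClosed k]
    {B : Type u} [Category.{v} B] [Preadditive B] [Linear k B]
    {A : Type u'} [Category.{v'} A] [Preadditive A] [Linear k A]
    (hB : CleavingFunctors.IsBoundedCategory k B) (hA : CleavingFunctors.IsBoundedCategory k A)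
    (hgl : CleavingFunctors.HasFiniteGlobalDimension k B)
    (m : ℕ) (hm : CleavingFunctors.IsStronglyUnbounded k B m)
    (F : B ⥤ A) [F.Additive] [F.Linear k] (hF : CleavingFunctors.IsCleaving k F) :
    CleavingFunctors.IsStronglyUnbounded k A m :=
  CleavingFunctors.IsStronglyUnbounded.of_isCleaving hB hA hm hF
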